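/- All graphs are finite and simple. $d(H)=2|E(H)|/|V(H)|$ and $\Delta(H)$ are the average and maximum degree of $H$, $\alpha(H)$ is its independence number, $N_H[I]$ is the closed neighbourhood of $I$, and $\log$ is the natural logarithm. A graph is $K_{t,t,t}$-free if it has no (not necessarily induced) subgraph isomorphic to the complete tripartite graph $K_{t,t,t}$. \textbf{The nibble procedure.} Let $\varepsilon\in(0,1)$, $t\in\mathbb N$, and let $G$ be an $n$-vertex graph of average degree $d$. Start with $H_1=G$, $I=\varnothing$, $R_1=1$, $\tau=0$, $i=1$. Write $N_i=|V(H_i)|$ and $D_i=d(H_i)$. At iteration $i$: \begin{enumerate} \item If $D_i<d^{\varepsilon/8}$, or $R_i>d^{\varepsilon/20}$, or $\tau=\left\lceil \frac{10(1-\varepsilon/3)\log d}{(1+\varepsilon/5)\varepsilon}\right\rceil$, stop and return $(I,H_i)$. \item (Cleaning step.) Otherwise, if $H_i$ has a vertex of degree greater than $(1+\varepsilon/10)D_i$, choose any such vertex $v$ and put $H_{i+1}=H_i-v$ and $R_{i+1}=R_i\cdot\frac{N_i}{N_i-1}$, leaving $I$ and $\tau$ unchanged. \item (Nibble step.) Otherwise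 put $\kappa=\varepsilon/10$, $p=\kappa/D_i$, $\gamma=(1-p)^{\Delta(H_i)}$, $\beta=D_i^{-1/(20t^2)}$. Choose any independent set $I_i$ of $H_i$ and any induced subgraph $\tilde H_i$ of $H_i-N_{H_i}[I_i]$ with $$|I_i|\ge(1-2\kappa)N_ip,\qquad (1-\beta)\gamma(1-p)N_i\le|V(\tilde H_i)|\le(1+\beta)\gamma(1-p)N_i,\qquad d(\tilde H_i)\le(1+4\beta)\gamma D_i.$$ Replace $I$ by $I\cup I_i$ and $\tau$ by $\tau+1$, and put $H_{i+1}=\tilde H_i$, $R_{i+1}=R_i$. \end{enumerate} Then pass to iteration $i+1$. \textbf{Proposition.} For all $\varepsilon\in(0,1)$ and $t\in\mathbb N$ there is $d_0$ such that for every real $d\ge d_0$ there is $n_0$ such that for every $n\ge n_0$ and every $n$-vertex $K_{t,t,t}$-free graph $G$ of average degree $d$ the following holds. The procedure on $(G,\varepsilon)$ is well defined and terminates: no run is infinite, and in every run, whenever a nibble step is called for, a pair $(I_i,\tilde H_i)$ as required exists. For every possible output $(I,H)$, whatever choices were made, $I$ is an independent set of $G$, $H$ is an induced subgraph of $G-N_G[I]$,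 and $$|I|\ge(1-\varepsilon)\frac{n\log d}{d}\qquad\text{or}\qquad\alpha(H)\ge(1-\varepsilon)\frac{n\log d}{d}.$$ Consequently $\alpha(G)\ge(1-\varepsilon)\frac{n\log d}{d}$. -/

import Mathlib

open Classical in
/-- The average degree `d(G) = (∑ v, deg v) / |V(G)| = 2 |E(G)| / |V(G)|` of a finite graph. -/
noncomputable def avgDegree {V : Type*} [Fintype V] (G : SimpleGraph V) : ℝ :=
  (∑ v : V, (G.degree v : ℝ)) / (Fintype.card V : ℝ)

open Classical in
/-- The maximum degree `Δ(G)` of a finite graph. -/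
noncomputable def maxDeg {V : Type*} [Fintype V] (G : SimpleGraph V) : ℕ :=
  G.maxDegree

/-- The subgraph `G[U]` of `G` induced by a finite set `U` of vertices. -/
abbrev inducedOn {V : Type*} (G : SimpleGraph V) (U : Finset V) :
    SimpleGraph ((U : Set V) : Type _) :=
  G.induce (U : Set V)

/-- `IsNibbleOutcome t κ G U I K` : with `H = G[U]`, `N = |V(H)|`, `D = d(H)`, `Δ = Δ(H)`,
`p = κ / D`, `γ = (1 - p) ^ Δ`, `β = D ^ (-1 / (20 t ^ 2))`, the set `I` is an independent set
of `H`, the graph `G[K] = H[K]` is an induced subgraph of `H - N[I]`, and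
* `|I| ≥ (1 - 2 κ) N p`,
* `(1 - β) γ (1 - p) N ≤ |K| ≤ (1 + β) γ (1 - p) N`,
* `d(G[K]) ≤ (1 + 4 β) γ D`. -/
def IsNibbleOutcome {V : Type*} (t : ℕ) (κ : ℝ) (G : SimpleGraph V)
    (U I K : Finset V) : Prop :=
  let N : ℝ := (U.card : ℝ)
  let D : ℝ := avgDegree (inducedOn G U)
  let p : ℝ := κ / D
  let γ : ℝ := (1 - p) ^ maxDeg (inducedOn G U)
  let β : ℝ := D ^ (-(1 / (20 * (t : ℝ) ^ 2)))
  I ⊆ U ∧ G.IsIndepSet (I : Set V) ∧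
  K ⊆ U ∧ (∀ v ∈ K, v ∉ I ∧ ∀ u ∈ I, ¬ G.Adj u v) ∧
  (1 - 2 * κ) * N * p ≤ (I.card : ℝ) ∧
  (1 - β) * (γ * (1 - p) * N) ≤ (K.card : ℝ) ∧
  (K.card : ℝ) ≤ (1 + β) * (γ * (1 - p) * N) ∧
  avgDegree (inducedOn G K) ≤ (1 + 4 * β) * γ * D

/-- The data held by the nibble procedure at the start of an iteration `i`:
the independent set `I` accumulated so far, the vertex set of the current graph `H_i`
(an induced subgraph of the input graph), the number `R_i`, and the counter `τ`. -/
structure NibbleState (V : Type*) where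
  I : Finset V
  U : Finset V
  R : ℝ
  τ : ℕ

/-- The initial state: `I = ∅`, `H_1 = G`, `R_1 = 1`, `τ = 0`. -/
def NibbleState.init (V : Type*) [Fintype V] : NibbleState V where
  I := ∅
  U := Finset.univ
  R := 1
  τ := 0

/-- The current graph `H_i`, as an induced subgraph of the input graph `G`. -/
abbrev NibbleState.graph {V : Type*} (G : SimpleGraph V) (s : NibbleState V) :
    SimpleGraph ((s.U : Set V) : Type _) :=
  inducedOn G s.U

/-- `D_i = d(H_i)`. -/
noncomputable def NibbleState.D {V : Type*} (G : SimpleGraph V) (s : NibbleState V) : ℝ :=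
  avgDegree (s.graph G)

/-- `N_i = |V(H_i)|`. -/
def NibbleState.N {V : Type*} (s : NibbleState V) : ℕ :=
  s.U.card

/-- The stopping rule, where `d = d(G)` is the average degree of the input graph:
`D_i < d ^ (ε / 8)`, or `R_i > d ^ (ε / 20)`, or
`τ = ⌈10 (1 - ε / 3) log d / ((1 + ε / 5) ε)⌉`. -/
def NibbleState.Stopped {V : Type*} [Fintype V] (ε : ℝ) (G : SimpleGraph V)
    (s : NibbleState V) : Prop :=
  s.D G < avgDegree G ^ (ε / 8) ∨
  avgDegree G ^ (ε / 20) < s.R ∨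
  s.τ = ⌈10 * (1 - ε / 3) * Real.log (avgDegree G) / ((1 + ε / 5) * ε)⌉₊

open Classical in
/-- One iteration of the nibble procedure on the input `(G, ε)`, from a state in which it does
not stop. A cleaning step deletes any vertex of degree greater than `(1 + ε / 10) D_i`;
if there is none, a nibble step with `κ = ε / 10` is made. Every legal choice of
the deleted vertex, and of the pair produced by a nibble step, is allowed. -/
inductive NibbleStep {V : Type*} [Fintype V] (t : ℕ) (ε : ℝ) (G : SimpleGraph V) :
    NibbleState V → NibbleState V → Prop
  | clean (s : NibbleState V) (v : ((s.U : Set V) : Type _))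
      (hgo : ¬ s.Stopped ε G)
      (hv : (1 + ε / 10) * s.D G < ((s.graph G).degree v : ℝ)) :
      NibbleStep t ε G s
        { I := s.I
          U := s.U.erase v.1
          R := s.R * ((s.N : ℝ) / ((s.N : ℝ) - 1))
          τ := s.τ }
  | nibble (s : NibbleState V) (J K : Finset V)
      (hgo : ¬ s.Stopped ε G)
      (hmax : (maxDeg (s.graph G) : ℝ) ≤ (1 + ε / 10) * s.D G)
      (hout : IsNibbleOutcome t (ε / 10) G s.U J K) :
      NibbleStep t ε G s
        { I := s.I ∪ J
          U := K
          R := s.R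
          τ := s.τ + 1 }

/-- `s` occurs in some run of the nibble procedure on `(G, ε)`. -/
def NibbleReachable {V : Type*} [Fintype V] (t : ℕ) (ε : ℝ) (G : SimpleGraph V)
    (s : NibbleState V) : Prop :=
  Relation.ReflTransGen (NibbleStep t ε G) (NibbleState.init V) s

/-- The nibble procedure on `(G, ε)` is well defined: no run is infinite, and no run gets stuck
before the stopping rule applies (so that a nibble step can be made whenever it is called for).
Hence every run can be continued until it returns an output. -/
def NibbleWellDefined {V : Type*} [Fintype V] (t : ℕ) (ε : ℝ) (G : SimpleGraph V) : Prop :=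
  (¬ ∃ f : ℕ → NibbleState V,
      f 0 = NibbleState.init V ∧ ∀ i, NibbleStep t ε G (f i) (f (i + 1))) ∧
  ∀ s, NibbleReachable t ε G s → s.Stopped ε G ∨ ∃ s', NibbleStep t ε G s s'

/-- Some run of the nibble procedure on `(G, ε)` returns the pair `(I, G[U])`. -/
def IsNibbleOutput {V : Type*} [Fintype V] (t : ℕ) (ε : ℝ) (G : SimpleGraph V)
    (I U : Finset V) : Prop :=
  ∃ s : NibbleState V, NibbleReachable t ε G s ∧ s.Stopped ε G ∧ s.I = I ∧ s.U = U

/-! A nibble picks each vertex with probability `κ / D`. It adds about `κ N / D` vertices to `I`,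
while the order and the average degree both shrink by a factor close to `exp (-κ)`. Thus `N / D`
stays close to `n / d` or above it, and about `log d / κ` nibbles can be made before the degree is
used up, for a total of about `(n / d) log d`.

The degree shrinks as fast as the order because triangles are rare. After an equalising deletion
every vertex survives with the same probability, and an edge with `c` common neighbours survives
with probability `(1 - p) ^ (2 Δ - c)`. Two rounds of Kővári–Sós–Turán bound the sum of the `c` by
`C N Δ ^ (2 - 1 / t ^ 2)` (`exists_codegreeSum_le`), an error below `β`. Since `d` is fixed and `n`
is huge, second moments suffice for concentration (`variance_avoidCount_le`). This yields
`exists_isNibbleOutcome`.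

Cleaning is paid for through `R`: deleting a vertex of large degree keeps `N R` and does not lower
`N / (D R ^ (2 κ))` (`cleaning_arith`). Nibbles cost `N R` a factor `exp (-(κ (1 + κ) + 5 b))` and
cost the ratio only `1 - 6 b`. Both bounds are part of `NibbleInvariant`.

Each stopping reason then gives a large independent set (`LargeDegree.final_bound`). If `τ` is
maximal, `I` is large. Otherwise `α(H) ≥ N / (4 D + 4)` is enough: a large `R` has raised `N / D` by
a power of `d`, and a small `D` meets the lower bound for `N`, in each case beating `log d`. -/

/-! ### Random subsets with independent elements -/

section RandomSubset

open Finset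

variable {Ω J : Type*} [Fintype Ω] [DecidableEq Ω] [Fintype J]

/-- The probability of the subset `X` when every `i` is chosen independently with
probability `q i`. -/
noncomputable def subsetWeight (q : Ω → ℝ) (X : Finset Ω) : ℝ :=
  (∏ i ∈ X, q i) * ∏ i ∈ Xᶜ, (1 - q i)

lemma subsetWeight_nonneg {q : Ω → ℝ} (h0 : ∀ i, 0 ≤ q i) (h1 : ∀ i, q i ≤ 1)
    (X : Finset Ω) : 0 ≤ subsetWeight q X :=
  mul_nonneg (prod_nonneg fun i _ => h0 i) (prod_nonneg fun i _ => sub_nonneg.2 (h1 i))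

/-- The random subset avoids `A` with probability `∏ i ∈ A, (1 - q i)`. -/
lemma sum_subsetWeight_disjoint (q : Ω → ℝ) (A : Finset Ω) :
    ∑ X : Finset Ω, subsetWeight q X * (if Disjoint A X then 1 else 0)
      = ∏ i ∈ A, (1 - q i) := by
  -- Expanding `∏ (q i + (1 - q i))` with `q` set to zero on `A` kills exactly the terms of the `X`
  -- that meet `A`.
  have h := Fintype.prod_add (fun i => if i ∈ A then 0 else q i) (fun i => 1 - q i)
  have h2 : ∏ i, ((if i ∈ A then 0 else q i) + (1 - q i)) = ∏ i ∈ A, (1 - q i) := by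
    rw [← Finset.prod_subset (subset_univ A)]
    · exact prod_congr rfl fun i hi => by simp [hi]
    · intro i _ hi
      simp [hi]
  rw [← h2, h]
  refine sum_congr rfl fun X _ => ?_
  rw [subsetWeight]
  split_ifs with hd
  · rw [mul_one]
    congr 1
    refine prod_congr rfl fun i hi => ?_
    rw [if_neg fun hA => disjoint_left.1 hd hA hi]
  · obtain ⟨i, hA, hX⟩ := not_disjoint_iff.1 hd
    have h0 : (∏ a ∈ X, if a ∈ A then 0 else q a) = 0 := prod_eq_zero hX (if_pos hA)
    rw [h0, zero_mul, mul_zero]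

lemma sum_subsetWeight (q : Ω → ℝ) : ∑ X : Finset Ω, subsetWeight q X = 1 := by
  simpa using sum_subsetWeight_disjoint q ∅

/-- Some outcome is at most the average. -/
lemma exists_le_of_sum_subsetWeight {q : Ω → ℝ} (h0 : ∀ i, 0 ≤ q i) (h1 : ∀ i, q i ≤ 1)
    (f : Finset Ω → ℝ) {B : ℝ} (h : ∑ X, subsetWeight q X * f X ≤ B) : ∃ X, f X ≤ B := by
  by_contra! hc
  have h3 : ∑ X, subsetWeight q X * B = B := by rw [← sum_mul, sum_subsetWeight, one_mul]
  have h4 : ∃ X, 0 < subsetWeight q X := by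
    by_contra! h5
    have := sum_subsetWeight q
    have h6 : ∑ X : Finset Ω, subsetWeight q X ≤ 0 := sum_nonpos fun X _ => h5 X
    linarith
  obtain ⟨X₀, hX₀⟩ := h4
  have : ∑ X, subsetWeight q X * B < ∑ X, subsetWeight q X * f X :=
    sum_lt_sum (fun X _ => mul_le_mul_of_nonneg_left (hc X).le (subsetWeight_nonneg h0 h1 X))
      ⟨X₀, mem_univ _, mul_lt_mul_of_pos_left (hc X₀) hX₀⟩
  linarith

/-- The number of sets of the family `A` that `X` avoids. -/
def avoidCount (A : J → Finset Ω) (X : Finset Ω) : ℝ :=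
  ∑ j, if Disjoint (A j) X then 1 else 0

lemma sum_subsetWeight_avoidCount (q : Ω → ℝ) (A : J → Finset Ω) :
    ∑ X, subsetWeight q X * avoidCount A X = ∑ j, ∏ i ∈ A j, (1 - q i) := by
  simp_rw [avoidCount, mul_sum]
  rw [sum_comm]
  exact sum_congr rfl fun j _ => sum_subsetWeight_disjoint q (A j)

/-- The variance of the number of avoided sets is small if no element lies in many of them. -/
lemma variance_avoidCount_le {q : Ω → ℝ} (h0 : ∀ i, 0 ≤ q i) (h1 : ∀ i, q i ≤ 1)
    (A : J → Finset Ω) {c : ℕ} (hc : ∀ i, #{j | i ∈ A j} ≤ c) :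
    ∑ X, subsetWeight q X * (avoidCount A X - ∑ j, ∏ i ∈ A j, (1 - q i)) ^ 2
      ≤ Fintype.card Ω * (c : ℝ) ^ 2 := by
  set P : J → ℝ := fun j => ∏ i ∈ A j, (1 - q i) with hP
  have hP0 : ∀ B : Finset Ω, 0 ≤ ∏ i ∈ B, (1 - q i) := fun B =>
    prod_nonneg fun i _ => sub_nonneg.2 (h1 i)
  have hP1 : ∀ B : Finset Ω, ∏ i ∈ B, (1 - q i) ≤ 1 := fun B =>
    prod_le_one (fun i _ => sub_nonneg.2 (h1 i)) fun i _ => by linarith [h0 i]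
  have e1 : ∑ X, subsetWeight q X * (avoidCount A X - ∑ j, P j) ^ 2
      = ∑ X, subsetWeight q X * avoidCount A X ^ 2 - (∑ j, P j) ^ 2 := by
    have : ∀ X, subsetWeight q X * (avoidCount A X - ∑ j, P j) ^ 2
      = subsetWeight q X * avoidCount A X ^ 2
        - 2 * (∑ j, P j) * (subsetWeight q X * avoidCount A X)
        + subsetWeight q X * (∑ j, P j) ^ 2 := fun X => by ring
    simp_rw [this, sum_add_distrib, sum_sub_distrib, ← mul_sum, ← sum_mul, sum_subsetWeight,
      sum_subsetWeight_avoidCount]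
    ring
  have e2 : ∑ X, subsetWeight q X * avoidCount A X ^ 2
      = ∑ j, ∑ k, ∏ i ∈ A j ∪ A k, (1 - q i) := by
    simp_rw [← sum_subsetWeight_disjoint]
    rw [sum_congr rfl fun j _ => sum_comm, sum_comm]
    refine sum_congr rfl fun X _ => ?_
    rw [avoidCount, sq, sum_mul_sum, mul_sum]
    refine sum_congr rfl fun j _ => ?_
    rw [mul_sum]
    refine sum_congr rfl fun k _ => ?_
    by_cases hj : Disjoint (A j) X <;> by_cases hk : Disjoint (A k) X <;>
      simp [disjoint_union_left, hj, hk]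
  rw [e1, e2, sq, sum_mul_sum, ← sum_sub_distrib]
  simp_rw [← sum_sub_distrib]
  -- The covariance of a pair vanishes if its two sets are disjoint and is at most 1 otherwise.
  -- Intersecting pairs are counted through their common elements.
  calc ∑ j, ∑ k, (∏ i ∈ A j ∪ A k, (1 - q i) - P j * P k)
      ≤ ∑ j, ∑ k, ∑ i, (if i ∈ A j then (1 : ℝ) else 0) * (if i ∈ A k then 1 else 0) := by
        refine sum_le_sum fun j _ => sum_le_sum fun k _ => ?_
        have hnn : ∀ i ∈ univ, 0 ≤ (if i ∈ A j then (1 : ℝ) else 0) * (if i ∈ A k then 1 else 0) :=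
          fun i _ => by positivity
        by_cases hd : Disjoint (A j) (A k)
        · rw [prod_union hd, sub_self]
          exact sum_nonneg hnn
        · obtain ⟨i, hi, hi'⟩ := not_disjoint_iff.1 hd
          have := single_le_sum hnn (mem_univ i)
          simp only [hi, hi', if_true, mul_one] at this
          have h2 := hP1 (A j ∪ A k)
          have h3 := mul_nonneg (hP0 (A j)) (hP0 (A k))
          simp only [hP]
          linarith
    _ = ∑ i, (∑ j, if i ∈ A j then (1 : ℝ) else 0) * (∑ k, if i ∈ A k then (1 : ℝ) else 0) := by
        simp_rw [sum_mul_sum]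
        rw [sum_congr rfl fun j _ => sum_comm, sum_comm]
    _ ≤ ∑ i : Ω, (c : ℝ) ^ 2 := by
        refine sum_le_sum fun i _ => ?_
        have h2 : (∑ j, if i ∈ A j then (1 : ℝ) else 0) ≤ c := by
          rw [sum_boole]
          exact_mod_cast hc i
        rw [← sq]
        exact pow_le_pow_left₀ (sum_nonneg fun j _ => by positivity) h2 2
    _ = Fintype.card Ω * (c : ℝ) ^ 2 := by simp

end RandomSubset

/-! ### Triangles in graphs without `K_{t,t,t}` -/

section Triangles

open Finset

/-- For `n ≥ 2 t` every factor of the falling factorial is at least `n / 2`; smaller `n` are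
absorbed by the constant. -/
lemma pow_le_descFactorial_add (n t : ℕ) :
    n ^ t ≤ 2 ^ t * n.descFactorial t + (2 * t) ^ t := by
  rcases le_total n (2 * t) with h | h
  · exact (Nat.pow_le_pow_left h t).trans (Nat.le_add_left _ _)
  · calc n ^ t ≤ (2 * (n + 1 - t)) ^ t := Nat.pow_le_pow_left (by omega) t
      _ = 2 ^ t * (n + 1 - t) ^ t := mul_pow _ _ _
      _ ≤ 2 ^ t * n.descFactorial t := Nat.mul_le_mul_left _ (Nat.pow_sub_le_descFactorial n t)
      _ ≤ _ := Nat.le_add_right _ _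

/-- Double counting of the injective `t`-tuples inside the sets `{s | r b s}`. -/
lemma sum_descFactorial_eq {B S : Type*} [Fintype S] (F : Finset B) (r : B → S → Prop)
    [∀ b, DecidablePred (r b)] (t : ℕ) :
    ∑ b ∈ F, (#{s | r b s}).descFactorial t
      = ∑ x : Fin t ↪ S, #{b ∈ F | ∀ i, r b (x i)} := by
  simp_rw [card_filter _ F]
  rw [sum_comm]
  refine sum_congr rfl fun b _ => ?_
  rw [← card_filter, ← Fintype.card_coe, ← Fintype.card_fin t, ← Fintype.card_embedding_eq,
    Fintype.card_fin, ← Fintype.card_subtype]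
  refine Fintype.card_congr
    { toFun := fun f => ⟨f.trans (Function.Embedding.subtype _), fun i => by
        exact (mem_filter.1 (f i).2).2⟩
      invFun := fun f => ⟨fun i => ⟨f.1 i, by simpa using f.2 i⟩, fun i j h => by
        simpa using h⟩
      left_inv := fun f => by ext; rfl
      right_inv := fun f => by ext; rfl }

/-- The convexity step of Kővári–Sós–Turán: power means, then falling factorials in place of powers,
since these count `t`-tuples. It serves twice, for edges inside a common neighbourhood and for
triangles over edges. -/
lemma pow_sum_card_le {B S : Type*} [Fintype S] (F : Finset B) (r : B → S → Prop)
    [∀ b, DecidablePred (r b)] {t : ℕ} (ht : 1 ≤ t) :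
    (∑ b ∈ F, #{s | r b s}) ^ t
      ≤ #F ^ (t - 1) * (2 ^ t * ∑ x : Fin t ↪ S, #{b ∈ F | ∀ i, r b (x i)}
        + #F * (2 * t) ^ t) := by
  have h1 : (∑ b ∈ F, #{s | r b s}) ^ t ≤ #F ^ (t - 1) * ∑ b ∈ F, #{s | r b s} ^ t := by
    obtain ⟨k, rfl⟩ : ∃ k, t = k + 1 := ⟨t - 1, by omega⟩
    exact pow_sum_le_card_mul_sum_pow (fun _ _ => Nat.zero_le _) k
  refine h1.trans (Nat.mul_le_mul_left _ ?_)
  rw [← sum_descFactorial_eq, mul_sum]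
  calc ∑ b ∈ F, #{s | r b s} ^ t
      ≤ ∑ b ∈ F, (2 ^ t * (#{s | r b s}).descFactorial t + (2 * t) ^ t) :=
        sum_le_sum fun b _ => pow_le_descFactorial_add _ _
    _ = _ := by rw [sum_add_distrib, sum_const, smul_eq_mul]

open Classical in
/-- The Kővári–Sós–Turán bound: ordered pairs of adjacent vertices inside a set `S` which does not
contain a `K_{t,t}`. -/
lemma pow_card_adj_le {W : Type*} [Fintype W] (G : SimpleGraph W) {t : ℕ} (ht : 1 ≤ t)
    (S : Finset W)
    (hfree : ∀ y z : Fin t ↪ W, (∀ i, y i ∈ S) → (∀ i, z i ∈ S) → ¬ ∀ i j, G.Adj (y i) (z j)) :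
    #{b : W × W | G.Adj b.1 b.2 ∧ b.1 ∈ S ∧ b.2 ∈ S} ^ t
      ≤ (2 ^ t * t + (2 * t) ^ t) * #S ^ (2 * t - 1) := by
  have hcard : #{b : W × W | G.Adj b.1 b.2 ∧ b.1 ∈ S ∧ b.2 ∈ S}
      = ∑ b ∈ S, #{s : S | G.Adj b s} := by
    rw [← card_sigma]
    refine card_bij' (fun b hb => ⟨b.1, ⟨b.2, (mem_filter.1 hb).2.2.2⟩⟩)
      (fun b _ => (b.1, b.2.1)) ?_ ?_ ?_ ?_
    · intro b hb
      simp only [mem_filter, mem_univ, true_and] at hb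
      simp [hb]
    · rintro ⟨b, s⟩ hb
      simp only [mem_sigma, mem_filter, mem_univ, true_and] at hb
      simp [hb]
    · intro b hb
      rfl
    · intro b hb
      rfl
  rw [hcard]
  refine (pow_sum_card_le S (fun b (s : S) => G.Adj b s) ht).trans ?_
  -- More than `t` common neighbours in `S` of a `t`-tuple of `S` would give a `K_{t,t}` in `S`.
  have h1 : ∑ x : Fin t ↪ S, #{b ∈ S | ∀ i, G.Adj b (x i)} ≤ #S ^ t * t := by
    calc ∑ x : Fin t ↪ S, #{b ∈ S | ∀ i, G.Adj b (x i)} ≤ ∑ x : Fin t ↪ S, t := by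
          refine sum_le_sum fun x _ => ?_
          by_contra! hlt
          have hne : Nonempty (Fin t ↪ {b // b ∈ S.filter fun b => ∀ i, G.Adj b (x i)}) := by
            rw [Function.Embedding.nonempty_iff_card_le]
            rw [Fintype.card_fin, Fintype.card_coe]
            exact hlt.le
          obtain ⟨y⟩ := hne
          refine hfree (y.trans (Function.Embedding.subtype _))
            (x.trans (Function.Embedding.subtype _)) (fun i => (mem_filter.1 (y i).2).1)
            (fun i => (x i).2) fun i j => (mem_filter.1 (y i).2).2 j
      _ = (#S).descFactorial t * t := by
          rw [sum_const, card_univ, Fintype.card_embedding_eq, smul_eq_mul, Fintype.card_fin,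
            Fintype.card_coe]
      _ ≤ #S ^ t * t := Nat.mul_le_mul_right _ (Nat.descFactorial_le_pow _ _)
  have h2 : #S ≤ #S ^ t := Nat.le_self_pow (by omega) _
  calc #S ^ (t - 1) * (2 ^ t * ∑ x : Fin t ↪ S, #{b ∈ S | ∀ i, G.Adj b (x i)} + #S * (2 * t) ^ t)
      ≤ #S ^ (t - 1) * (2 ^ t * (#S ^ t * t) + #S ^ t * (2 * t) ^ t) := by gcongr
    _ = (2 ^ t * t + (2 * t) ^ t) * #S ^ (2 * t - 1) := by
        rw [show 2 * t - 1 = (t - 1) + t by omega, pow_add]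
        ring

open Classical in
/-- In a graph without a `K_{t,t,t}`, the common neighbourhood of `t` vertices spans few edges. -/
lemma card_adj_commonNeighbors_le {W : Type*} [Fintype W] (G : SimpleGraph W) {t Δ : ℕ}
    (ht : 1 ≤ t) (hdeg : ∀ v, #{w | G.Adj v w} ≤ Δ)
    (hfree : (SimpleGraph.completeEquipartiteGraph 3 t).Free G) (x : Fin t ↪ W) :
    (#{b : W × W | G.Adj b.1 b.2 ∧ ∀ i, G.Adj b.1 (x i) ∧ G.Adj b.2 (x i)} : ℝ)
      ≤ ((2 ^ t * t + (2 * t) ^ t : ℕ) : ℝ) ^ (1 / (t : ℝ)) * (Δ : ℝ) ^ (1 - 1 / (t : ℝ))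
        * #{v | ∀ i, G.Adj v (x i)} := by
  set c : ℕ := 2 ^ t * t + (2 * t) ^ t with hc
  have htR : (0 : ℝ) < t := by exact_mod_cast ht
  have hc0 : (0 : ℝ) < c := by rw [hc]; positivity
  set lam : ℝ := (c : ℝ) ^ (1 / (t : ℝ)) * (Δ : ℝ) ^ (1 - 1 / (t : ℝ)) with hlam
  set S : Finset W := {v | ∀ i, G.Adj v (x i)} with hS
  have hSΔ : #S ≤ Δ := by
    refine (card_le_card fun v hv => ?_).trans (hdeg (x ⟨0, ht⟩))
    simp only [hS, mem_filter, mem_univ, true_and] at hv ⊢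
    exact (hv _).symm
  -- A `K_{t,t}` inside the common neighbourhood of `x` extends `x` to a `K_{t,t,t}`. Distinct parts
  -- are disjoint because adjacent vertices differ.
  have hk := pow_card_adj_le G ht S (by
    intro y z hy hz hyz
    have hyx : ∀ i j, G.Adj (y i) (x j) := fun i => (mem_filter.1 (hy i)).2
    have hzx : ∀ i j, G.Adj (z i) (x j) := fun i => (mem_filter.1 (hz i)).2
    have hadj : ∀ a b : Fin 3 × Fin t, a.1 ≠ b.1 →
        G.Adj (![⇑x, ⇑y, ⇑z] a.1 a.2) (![⇑x, ⇑y, ⇑z] b.1 b.2) := by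
      rintro ⟨a, i⟩ ⟨b, j⟩ hab
      fin_cases a <;> fin_cases b <;>
        simp [hyz, (hyz _ _).symm, hyx, (hyx _ _).symm, hzx, (hzx _ _).symm] at hab ⊢
    refine hfree ⟨⟨⟨fun a => ![⇑x, ⇑y, ⇑z] a.1 a.2, fun {a b} h => hadj a b h⟩, ?_⟩⟩
    rintro ⟨a, i⟩ ⟨b, j⟩ hab
    by_cases h : a = b
    · subst h
      congr 1
      fin_cases a
      · exact x.injective hab
      · exact y.injective hab
      · exact z.injective hab
    · exact absurd hab (hadj (a, i) (b, j) h).ne)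
  have he : ({b | G.Adj b.1 b.2 ∧ ∀ i, G.Adj b.1 (x i) ∧ G.Adj b.2 (x i)} : Finset (W × W))
      = ({b : W × W | G.Adj b.1 b.2 ∧ b.1 ∈ S ∧ b.2 ∈ S} : Finset (W × W)) := by
    ext b
    simp [hS, forall_and]
  rw [he]
  set e := #{b : W × W | G.Adj b.1 b.2 ∧ b.1 ∈ S ∧ b.2 ∈ S}
  -- Only `t - 1` of the factors `#S` are replaced by `Δ`, so that the `t`-th root is linear in `#S`
  -- and can be summed over `x`.
  have hk2 : e ^ t ≤ c * (#S ^ t * Δ ^ (t - 1)) := by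
    refine hk.trans (Nat.mul_le_mul_left _ ?_)
    rw [show 2 * t - 1 = t + (t - 1) by omega, pow_add]
    gcongr
  refine le_of_pow_le_pow_left₀ (n := t) (by omega) (by positivity) ?_
  have hl : lam ^ t = c * (Δ : ℝ) ^ (t - 1) := by
    rw [hlam, mul_pow, ← Real.rpow_natCast, ← Real.rpow_mul hc0.le,
      ← Real.rpow_natCast ((Δ : ℝ) ^ _), ← Real.rpow_mul (by positivity),
      one_div_mul_cancel htR.ne', Real.rpow_one, ← Real.rpow_natCast (Δ : ℝ) (t - 1)]
    congr 2
    rw [Nat.cast_sub ht]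
    field_simp
    simp
  rw [mul_pow, hl]
  calc (e : ℝ) ^ t ≤ ((c * (#S ^ t * Δ ^ (t - 1)) : ℕ) : ℝ) := by exact_mod_cast hk2
    _ = _ := by push_cast; ring

/-- The `t`-th root in the second round, with `D` in the role of `Δ`. The power of `D` is `(t - 1) +
(t + 1 - 1 / t) = 2 t - 1 / t`, whence the exponent `2 - 1 / t ^ 2`; the term with `(2 t) ^ t` has
lower order and is absorbed by `1 ≤ D`. -/
lemma le_of_pow_le_triangle_bound {t : ℕ} (ht : 1 ≤ t) {c N D e Q T : ℝ} (hc : 0 < c)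
    (hN : 0 ≤ N) (hD : 1 ≤ D) (he0 : 0 ≤ e) (he : e ≤ N * D) (hQ0 : 0 ≤ Q)
    (hQ : Q ≤ c ^ (1 / (t : ℝ)) * D ^ (1 - 1 / (t : ℝ)) * (N * D ^ t))
    (hT : T ^ t ≤ e ^ (t - 1) * (2 ^ t * Q + e * (2 * t) ^ t)) :
    T ≤ (2 ^ t * c ^ (1 / (t : ℝ)) + (2 * t) ^ t) ^ (1 / (t : ℝ))
      * (N * D ^ (2 - 1 / (t : ℝ) ^ 2)) := by
  have htR : (0 : ℝ) < t := by exact_mod_cast ht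
  have ht1 : (1 : ℝ) ≤ t := by exact_mod_cast ht
  have hD0 : 0 < D := by linarith
  have hc'0 : 0 < 2 ^ t * c ^ (1 / (t : ℝ)) + (2 * t) ^ t := by positivity
  refine le_of_pow_le_pow_left₀ (n := t) (by omega) (by positivity) (hT.trans ?_)
  have hpow : D ^ (t - 1) * D ^ (1 - 1 / (t : ℝ)) = D ^ ((t : ℝ) - 1 / t) := by
    rw [← Real.rpow_natCast, ← Real.rpow_add hD0, Nat.cast_sub ht]
    congr 1
    push_cast
    ring
  have h1le : 1 ≤ D ^ ((t : ℝ) - 1 / t) := by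
    refine Real.one_le_rpow hD ?_
    have : 1 / (t : ℝ) ≤ 1 := (div_le_one htR).2 ht1
    linarith
  have hDt : D ^ t = D * D ^ (t - 1) := by rw [← pow_succ', Nat.sub_add_cancel ht]
  have hND : (N * D) ^ t = (N * D) ^ (t - 1) * (N * D) := by
    rw [← pow_succ, Nat.sub_add_cancel ht]
  have e1 : ((2 ^ t * c ^ (1 / (t : ℝ)) + (2 * t) ^ t) ^ (1 / (t : ℝ))) ^ t
      = 2 ^ t * c ^ (1 / (t : ℝ)) + (2 * t) ^ t := by
    rw [← Real.rpow_natCast, ← Real.rpow_mul hc'0.le, one_div_mul_cancel htR.ne', Real.rpow_one]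
  have e2 : (D ^ (2 - 1 / (t : ℝ) ^ 2)) ^ t = D ^ t * D ^ ((t : ℝ) - 1 / t) := by
    rw [← Real.rpow_natCast, ← Real.rpow_mul hD0.le, ← Real.rpow_natCast D t,
      ← Real.rpow_add hD0]
    congr 1
    field_simp
    ring
  calc e ^ (t - 1) * (2 ^ t * Q + e * (2 * t) ^ t)
      ≤ (N * D) ^ (t - 1) * (2 ^ t * (c ^ (1 / (t : ℝ)) * D ^ (1 - 1 / (t : ℝ)) * (N * D ^ t))
          + (N * D) * (2 * t) ^ t) := by
        gcongr
    _ = (N * D) ^ t * (2 ^ t * c ^ (1 / (t : ℝ)) * D ^ ((t : ℝ) - 1 / t) + (2 * t) ^ t * 1) := by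
        rw [hND, hDt, ← hpow]
        ring
    _ ≤ (N * D) ^ t * (2 ^ t * c ^ (1 / (t : ℝ)) * D ^ ((t : ℝ) - 1 / t)
          + (2 * t) ^ t * D ^ ((t : ℝ) - 1 / t)) := by gcongr
    _ = _ := by
        rw [mul_pow (_ ^ (1 / (t : ℝ))), e1, mul_pow N (D ^ (2 - _)), e2, mul_pow N D]
        ring

open Classical in
/-- A graph of maximum degree at most `Δ` without a `K_{t,t,t}` has few triangles. -/
theorem exists_sum_card_commonNeighbors_le (t : ℕ) (ht : 1 ≤ t) :
    ∃ C : ℝ, 0 < C ∧ ∀ (W : Type*) [Fintype W] (G : SimpleGraph W) (Δ : ℕ), 1 ≤ Δ →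
      (∀ v, #{w | G.Adj v w} ≤ Δ) → (SimpleGraph.completeEquipartiteGraph 3 t).Free G →
      ∑ b : W × W with G.Adj b.1 b.2, (#{s | G.Adj b.1 s ∧ G.Adj b.2 s} : ℝ)
        ≤ C * (Fintype.card W * (Δ : ℝ) ^ (2 - 1 / (t : ℝ) ^ 2)) := by
  have hc0 : (0 : ℝ) < ((2 ^ t * t + (2 * t) ^ t : ℕ) : ℝ) := by
    have : 0 < 2 ^ t * t + (2 * t) ^ t := by positivity
    exact_mod_cast this
  refine ⟨_, ?_, fun W _ G Δ hΔ hdeg hfree => le_of_pow_le_triangle_bound ht hc0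
    (e := (#{b : W × W | G.Adj b.1 b.2} : ℝ))
    (Q := ∑ x : Fin t ↪ W, (#{b : W × W | G.Adj b.1 b.2 ∧
      ∀ i, G.Adj b.1 (x i) ∧ G.Adj b.2 (x i)} : ℝ))
    (Nat.cast_nonneg _) (Nat.one_le_cast.2 hΔ) (Nat.cast_nonneg _)
    ?_ (sum_nonneg fun _ _ => Nat.cast_nonneg _) ?_ ?_⟩
  · positivity
  · have hFcard : #{b : W × W | G.Adj b.1 b.2} ≤ Fintype.card W * Δ := by
      rw [card_filter, Fintype.sum_prod_type]
      calc ∑ x : W, ∑ y : W, (if G.Adj x y then 1 else 0) ≤ ∑ x : W, Δ := by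
            refine sum_le_sum fun x _ => ?_
            rw [← card_filter]
            exact hdeg x
        _ = Fintype.card W * Δ := by simp
    exact_mod_cast hFcard
  -- Counted from `v`, this is the number of injective `t`-tuples in the neighbourhoods.
  · have hsum : (∑ x : Fin t ↪ W, #{v | ∀ i, G.Adj v (x i)}) ≤ Fintype.card W * Δ ^ t := by
      rw [← sum_descFactorial_eq univ (fun v w => G.Adj v w)]
      calc ∑ v : W, (#{w | G.Adj v w}).descFactorial t ≤ ∑ v : W, Δ ^ t :=
            sum_le_sum fun v _ => (Nat.descFactorial_le_pow _ _).trans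
              (Nat.pow_le_pow_left (hdeg v) t)
        _ = Fintype.card W * Δ ^ t := by simp
    refine (sum_le_sum fun x _ => card_adj_commonNeighbors_le G ht hdeg hfree x).trans ?_
    rw [← mul_sum]
    refine mul_le_mul_of_nonneg_left ?_ (by positivity)
    exact_mod_cast hsum
  · have key := pow_sum_card_le ({b | G.Adj b.1 b.2} : Finset (W × W))
      (fun b s => G.Adj b.1 s ∧ G.Adj b.2 s) ht
    simp only [filter_filter] at key
    exact_mod_cast key

open Classical in
/-- The number of common neighbours, summed over the ordered pairs of adjacent vertices. -/
noncomputable def codegreeSum {W : Type*} [Fintype W] (G : SimpleGraph W) : ℝ :=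
  ∑ b : W × W with G.Adj b.1 b.2, (#{s | G.Adj b.1 s ∧ G.Adj b.2 s} : ℝ)

open Classical in
lemma card_adj_le_maxDeg {W : Type*} [Fintype W] (G : SimpleGraph W) (v : W) :
    #{w | G.Adj v w} ≤ maxDeg G := by
  rw [maxDeg]
  convert G.degree_le_maxDegree v
  rw [← SimpleGraph.card_neighborFinset_eq_degree]
  congr 1
  ext w
  simp

/-- A graph without a `K_{t,t,t}` has few triangles. -/
theorem exists_codegreeSum_le (t : ℕ) (ht : 1 ≤ t) :
    ∃ C : ℝ, 0 < C ∧ ∀ (W : Type*) [Fintype W] (G : SimpleGraph W), 1 ≤ maxDeg G →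
      (SimpleGraph.completeEquipartiteGraph 3 t).Free G →
      codegreeSum G ≤ C * (Fintype.card W * (maxDeg G : ℝ) ^ (2 - 1 / (t : ℝ) ^ 2)) := by
  obtain ⟨C, hC, h⟩ := exists_sum_card_commonNeighbors_le t ht
  exact ⟨C, hC, fun W _ G hΔ hfree => h W G _ hΔ (card_adj_le_maxDeg G) hfree⟩

end Triangles

/-! ### One random nibble -/

section RandomNibble

open Finset

lemma avoidCount_eq_card {Ω J : Type*} [DecidableEq Ω] [Fintype J] (A : J → Finset Ω)
    (X : Finset Ω) : avoidCount A X = #{j | Disjoint (A j) X} := by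
  rw [avoidCount, sum_boole]

lemma disjoint_disjSum_iff {W : Type*} [DecidableEq W] (s t : Finset W) (X : Finset (W ⊕ W)) :
    Disjoint (s.disjSum t) X ↔ (∀ v ∈ s, Sum.inl v ∉ X) ∧ ∀ v ∈ t, Sum.inr v ∉ X := by
  rw [disjoint_left]
  constructor
  · exact fun h => ⟨fun v hv => h (inl_mem_disjSum.2 hv), fun v hv => h (inr_mem_disjSum.2 hv)⟩
  · rintro ⟨h1, h2⟩ (v | v) hv
    · exact h1 v (inl_mem_disjSum.1 hv)
    · exact h2 v (inr_mem_disjSum.1 hv)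

open Classical in
/-- If the elements of `A` are deleted with probability `p` each, and a vertex `v` is moreover
killed with probability `1 - (1 - p) ^ (Δ - deg v)`, then the survival probability of an edge is
`(1 - p) ^ (2 Δ - c)` where `c` is the number of common neighbours of its ends. -/
lemma one_sub_pow_card_union_le {W : Type*} [Fintype W] (H : SimpleGraph W) {Δ : ℕ}
    (hdeg : ∀ v, #{w | H.Adj v w} ≤ Δ) {p : ℝ} (hp0 : 0 ≤ p) (hp1 : p ≤ 1)
    (hpΔ : p * Δ ≤ 1 / 2) {u v : W} (huv : H.Adj u v) :
    (1 - p) ^ #(insert u ({w | H.Adj u w} : Finset W) ∪ insert v ({w | H.Adj v w} : Finset W))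
        * ((1 - p) ^ (Δ - #{w | H.Adj u w}) * (1 - p) ^ (Δ - #{w | H.Adj v w}))
      ≤ ((1 - p) ^ Δ) ^ 2 * (1 + 2 * p * #{s | H.Adj u s ∧ H.Adj v s}) := by
  set Nu : Finset W := {w | H.Adj u w} with hNu
  set Nv : Finset W := {w | H.Adj v w} with hNv
  set m := #{s | H.Adj u s ∧ H.Adj v s} with hm
  -- As `u` and `v` lie in both closed neighbourhoods, the union has `deg u + deg v - m` elements,
  -- and the total exponent is `2 Δ - m`.
  have hinter : #(insert u Nu ∩ insert v Nv) = m + 2 := by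
    have : insert u Nu ∩ insert v Nv
        = insert u (insert v ({s | H.Adj u s ∧ H.Adj v s} : Finset W)) := by
      ext w
      simp only [hNu, hNv, mem_inter, mem_insert, mem_filter, mem_univ, true_and]
      constructor
      · rintro ⟨h1 | h1, h2 | h2⟩ <;> simp [h1, h2]
      · rintro (rfl | rfl | h)
        · exact ⟨Or.inl rfl, Or.inr huv.symm⟩
        · exact ⟨Or.inr huv, Or.inl rfl⟩
        · exact ⟨Or.inr h.1, Or.inr h.2⟩
    rw [this, card_insert_of_notMem, card_insert_of_notMem]
    · simp
    · simp [huv.ne]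
  have hcu : #(insert u Nu) = #Nu + 1 := card_insert_of_notMem (by simp [hNu])
  have hcv : #(insert v Nv) = #Nv + 1 := card_insert_of_notMem (by simp [hNv])
  have hunion := card_union_add_card_inter (insert u Nu) (insert v Nv)
  have hu : #Nu ≤ Δ := hdeg u
  have hv : #Nv ≤ Δ := hdeg v
  have hmΔ : m ≤ Δ := (card_le_card fun w hw => by
    simp only [mem_filter, mem_univ, true_and] at hw ⊢
    exact hw.1).trans (hdeg u)
  have hq0 : 0 ≤ 1 - p := by linarith
  have hexp : (1 - p) ^ #(insert u Nu ∪ insert v Nv)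
        * ((1 - p) ^ (Δ - #Nu) * (1 - p) ^ (Δ - #Nv)) * (1 - p) ^ m = ((1 - p) ^ Δ) ^ 2 := by
    rw [← pow_add, ← pow_add, ← pow_add, ← pow_mul]
    congr 1
    omega
  have hpm : p * m ≤ 1 / 2 :=
    (mul_le_mul_of_nonneg_left (Nat.cast_le.2 hmΔ) hp0).trans hpΔ
  have hbern : 1 - p * m ≤ (1 - p) ^ m := by
    have := one_add_mul_le_pow (a := -p) (by linarith) m
    calc 1 - p * m = 1 + m * (-p) := by ring
      _ ≤ (1 + -p) ^ m := this
      _ = _ := by ring_nf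
  set E := (1 - p) ^ #(insert u Nu ∪ insert v Nv)
        * ((1 - p) ^ (Δ - #Nu) * (1 - p) ^ (Δ - #Nv))
  have hE : 0 ≤ E := by positivity
  have hpm0 : 0 ≤ p * m := by positivity
  rw [← hexp]
  have h1 : 1 ≤ (1 - p) ^ m * (1 + 2 * p * m) := by
    calc (1 : ℝ) ≤ (1 - p * m) * (1 + 2 * (p * m)) := by nlinarith
      _ ≤ (1 - p) ^ m * (1 + 2 * (p * m)) := by gcongr
      _ = _ := by ring
  calc E = E * 1 := (mul_one E).symm
    _ ≤ E * ((1 - p) ^ m * (1 + 2 * p * m)) := by gcongr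
    _ = _ := by ring

open Classical in
-- Some end of such an edge is among the `Δ + 1` vertices equal or adjacent to `x`, and the other
-- end is a neighbour of it; the factor 2 says which end. This limits the dependence between
-- surviving edges.
lemma card_adj_closedNeighbor_le {W : Type*} [Fintype W] (H : SimpleGraph W) {Δ : ℕ}
    (hdeg : ∀ v, #{w | H.Adj v w} ≤ Δ) (x : W) :
    #{b : {b : W × W // H.Adj b.1 b.2} | x ∈ insert b.1.1 ({w | H.Adj b.1.1 w} : Finset W)
      ∪ insert b.1.2 ({w | H.Adj b.1.2 w} : Finset W)} ≤ 2 * (Δ + 1) ^ 2 := by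
  set Nx : Finset W := insert x ({w | H.Adj x w} : Finset W) with hNx
  have hNxc : #Nx ≤ Δ + 1 := (card_insert_le _ _).trans (Nat.add_le_add_right (hdeg x) 1)
  set P : Finset (W × W) := (Nx.sigma fun u => ({w | H.Adj u w} : Finset W)).image
    (fun a => (a.1, a.2)) with hP
  have hPc : #P ≤ (Δ + 1) ^ 2 := by
    refine card_image_le.trans ?_
    rw [card_sigma]
    calc ∑ u ∈ Nx, #{w | H.Adj u w} ≤ ∑ u ∈ Nx, (Δ + 1) :=
          sum_le_sum fun u _ => (hdeg u).trans (Nat.le_succ _)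
      _ = #Nx * (Δ + 1) := by simp
      _ ≤ (Δ + 1) ^ 2 := by rw [sq]; gcongr
  rw [← card_map (Function.Embedding.subtype _)]
  calc _ ≤ #(P ∪ P.image Prod.swap) := by
        refine card_le_card ?_
        rintro ⟨u, v⟩ hb
        simp only [mem_map, mem_filter, mem_univ, true_and, mem_union, mem_insert,
          Function.Embedding.subtype_apply] at hb
        obtain ⟨⟨⟨u', v'⟩, huv⟩, hx, he⟩ := hb
        simp only [Prod.mk.injEq] at he huv hx
        obtain ⟨rfl, rfl⟩ := he
        simp only [hP, hNx, mem_union, mem_image, mem_sigma, mem_insert, mem_filter, mem_univ,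
          true_and, Sigma.exists, Prod.mk.injEq, Prod.exists, Prod.swap_prod_mk]
        rcases hx with hx | hx
        · exact Or.inl ⟨u', v', ⟨hx.imp Eq.symm SimpleGraph.Adj.symm, huv⟩, rfl, rfl⟩
        · exact Or.inr ⟨v', u', ⟨v', u', ⟨hx.imp Eq.symm SimpleGraph.Adj.symm, huv.symm⟩,
            rfl, rfl⟩, rfl, rfl⟩
    _ ≤ #P + #P := (card_union_le _ _).trans (Nat.add_le_add_left card_image_le _)
    _ ≤ 2 * (Δ + 1) ^ 2 := by omega

open Classical in
/-- The outcome of a random nibble, up to an error `η` of order `√|W|`. -/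
theorem exists_nibble_approx {W : Type*} [Fintype W] (H : SimpleGraph W) {Δ : ℕ}
    (hdeg : ∀ v, #{w | H.Adj v w} ≤ Δ) {p : ℝ} (hp0 : 0 ≤ p) (hp1 : p ≤ 1)
    (hpΔ : p * Δ ≤ 1 / 2) {η : ℝ} (hη0 : 0 ≤ η)
    (hη : 32 * Fintype.card W * ((Δ : ℝ) + 1) ^ 4 ≤ η ^ 2) :
    ∃ I K : Finset W, H.IsIndepSet (I : Set W) ∧ (∀ v ∈ K, v ∉ I ∧ ∀ u ∈ I, ¬ H.Adj u v) ∧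
      p * Fintype.card W - p ^ 2 * (∑ v, #{w | H.Adj v w} : ℕ) - 2 * η ≤ #I ∧
      |(#K : ℝ) - (1 - p) ^ Δ * (1 - p) * Fintype.card W| ≤ η ∧
      (#{b : W × W | H.Adj b.1 b.2 ∧ b.1 ∈ K ∧ b.2 ∈ K} : ℝ)
        ≤ ((1 - p) ^ Δ) ^ 2 * ((∑ v, #{w | H.Adj v w} : ℕ)
          + 2 * p * ∑ b : W × W with H.Adj b.1 b.2, (#{s | H.Adj b.1 s ∧ H.Adj b.2 s} : ℝ)) + η := by
  set Nb : W → Finset W := fun v => {w | H.Adj v w} with hNb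
  -- The coordinate `inl v` picks `v`. The coordinate `inr v` is the additional deletion that gives
  -- every vertex the survival probability `(1 - p) ^ (Δ + 1)`.
  set q : W ⊕ W → ℝ := Sum.elim (fun _ => p) (fun v => 1 - (1 - p) ^ (Δ - #(Nb v))) with hq
  have hq0 : ∀ i, 0 ≤ q i := by
    rintro (v | v)
    · exact hp0
    · exact sub_nonneg.2 (pow_le_one₀ (by linarith) (by linarith))
  have hq1 : ∀ i, q i ≤ 1 := by
    rintro (v | v)
    · exact hp1
    · have : 0 ≤ (1 - p) ^ (Δ - #(Nb v)) := pow_nonneg (by linarith) _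
      simp only [hq, Sum.elim_inr]
      linarith
  set c : ℕ := 2 * (Δ + 1) ^ 2 with hc
  have hprod : ∀ s t : Finset W, ∏ i ∈ s.disjSum t, (1 - q i)
      = (1 - p) ^ #s * ∏ v ∈ t, (1 - p) ^ (Δ - #(Nb v)) := by
    intro s t
    rw [prod_disjSum]
    simp [hq]
  have hmem : ∀ x : W, #{v | x ∈ insert v (Nb v)} ≤ c := by
    intro x
    calc #{v | x ∈ insert v (Nb v)} ≤ #(insert x (Nb x)) := by
          refine card_le_card fun v hv => ?_
          simp only [hNb, mem_filter, mem_univ, true_and, mem_insert] at hv ⊢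
          exact hv.imp Eq.symm SimpleGraph.Adj.symm
      _ ≤ Δ + 1 := (card_insert_le _ _).trans (Nat.add_le_add_right (hdeg x) 1)
      _ ≤ c := by rw [hc]; nlinarith
  -- the four families of sets to be avoided
  set A1 : W → Finset (W ⊕ W) := fun v => (Nb v).disjSum ∅ with hA1
  set A2 : W → Finset (W ⊕ W) := fun v => (insert v (Nb v)).disjSum ∅ with hA2
  set A3 : W → Finset (W ⊕ W) := fun v => (insert v (Nb v)).disjSum {v} with hA3
  set A4 : {b : W × W // H.Adj b.1 b.2} → Finset (W ⊕ W) := fun b =>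
    (insert b.1.1 (Nb b.1.1) ∪ insert b.1.2 (Nb b.1.2)).disjSum {b.1.1, b.1.2} with hA4
  have hA2c : ∀ i, #{v | i ∈ A2 v} ≤ c := by
    rintro (x | x)
    · simpa only [hA2, inl_mem_disjSum] using hmem x
    · simp [hA2]
  have hA1c : ∀ i, #{v | i ∈ A1 v} ≤ c := by
    intro i
    refine (card_le_card fun v hv => ?_).trans (hA2c i)
    simp only [mem_filter, mem_univ, true_and, hA1, hA2] at hv ⊢
    exact disjSum_mono (subset_insert _ _) subset_rfl hv
  have hA3c : ∀ i, #{v | i ∈ A3 v} ≤ c := by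
    rintro (x | x)
    · simpa only [hA3, inl_mem_disjSum] using hmem x
    · refine (card_le_card fun v hv => ?_).trans (hmem x)
      simp only [hA3, mem_filter, mem_univ, true_and, inr_mem_disjSum, mem_singleton] at hv ⊢
      simp [hv]
  have hA4c : ∀ i, #{b | i ∈ A4 b} ≤ c := by
    rintro (x | x)
    · simpa only [hA4, inl_mem_disjSum] using card_adj_closedNeighbor_le H hdeg x
    · refine (card_le_card fun b hb => ?_).trans (card_adj_closedNeighbor_le H hdeg x)
      simp only [hA4, mem_filter, mem_univ, true_and, inr_mem_disjSum, mem_singleton,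
        mem_insert, mem_union] at hb ⊢
      exact hb.imp Or.inl Or.inl
  have v1 := variance_avoidCount_le hq0 hq1 A1 hA1c
  have v2 := variance_avoidCount_le hq0 hq1 A2 hA2c
  have v3 := variance_avoidCount_le hq0 hq1 A3 hA3c
  have v4 := variance_avoidCount_le hq0 hq1 A4 hA4c
  -- One outcome must suit all four counts. The squared deviations sum to at most `4 * (2 |W|) * c ^
  -- 2 = 32 |W| (Δ + 1) ^ 4` on average.
  obtain ⟨X, hX⟩ := exists_le_of_sum_subsetWeight hq0 hq1
    (fun X => (avoidCount A1 X - ∑ j, ∏ i ∈ A1 j, (1 - q i)) ^ 2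
      + (avoidCount A2 X - ∑ j, ∏ i ∈ A2 j, (1 - q i)) ^ 2
      + (avoidCount A3 X - ∑ j, ∏ i ∈ A3 j, (1 - q i)) ^ 2
      + (avoidCount A4 X - ∑ j, ∏ i ∈ A4 j, (1 - q i)) ^ 2)
    (B := η ^ 2) (by
      simp_rw [mul_add, sum_add_distrib]
      have : (Fintype.card (W ⊕ W) : ℝ) * (c : ℝ) ^ 2
          = 8 * Fintype.card W * ((Δ : ℝ) + 1) ^ 4 := by
        rw [Fintype.card_sum, hc]
        push_cast
        ring
      linarith)
  have s1 := sq_nonneg (avoidCount A1 X - ∑ j, ∏ i ∈ A1 j, (1 - q i))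
  have s2 := sq_nonneg (avoidCount A2 X - ∑ j, ∏ i ∈ A2 j, (1 - q i))
  have s3 := sq_nonneg (avoidCount A3 X - ∑ j, ∏ i ∈ A3 j, (1 - q i))
  have s4 := sq_nonneg (avoidCount A4 X - ∑ j, ∏ i ∈ A4 j, (1 - q i))
  have dev : ∀ x : ℝ, x ^ 2 ≤ η ^ 2 → |x| ≤ η := fun x hx => abs_le_of_sq_le_sq hx hη0
  have d1 := dev _ (show (avoidCount A1 X - ∑ j, ∏ i ∈ A1 j, (1 - q i)) ^ 2 ≤ _ by linarith)
  have d2 := dev _ (show (avoidCount A2 X - ∑ j, ∏ i ∈ A2 j, (1 - q i)) ^ 2 ≤ _ by linarith)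
  have d3 := dev _ (show (avoidCount A3 X - ∑ j, ∏ i ∈ A3 j, (1 - q i)) ^ 2 ≤ _ by linarith)
  have d4 := dev _ (show (avoidCount A4 X - ∑ j, ∏ i ∈ A4 j, (1 - q i)) ^ 2 ≤ _ by linarith)
  clear v1 v2 v3 v4 s1 s2 s3 s4 hX hA1c hA2c hA3c hA4c dev
  have hNbc : ∀ v, #(insert v (Nb v)) = #(Nb v) + 1 := fun v =>
    card_insert_of_notMem (by simp [hNb])
  have m12 : p * Fintype.card W - p ^ 2 * (∑ v, #(Nb v) : ℕ)
      ≤ ∑ j, ∏ i ∈ A1 j, (1 - q i) - ∑ j, ∏ i ∈ A2 j, (1 - q i) := by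
    rw [← sum_sub_distrib]
    calc p * Fintype.card W - p ^ 2 * (∑ v, #(Nb v) : ℕ)
        = ∑ v, p * (1 - p * #(Nb v)) := by
          rw [← mul_sum, sum_sub_distrib, ← mul_sum]
          simp
          ring
      _ ≤ _ := by
          refine sum_le_sum fun v _ => ?_
          simp only [hA1, hA2, hprod, hNbc, prod_empty, mul_one, pow_succ]
          have := one_add_mul_le_pow (a := -p) (by linarith) #(Nb v)
          rw [← sub_eq_add_neg] at this
          nlinarith
  have m3 : ∑ j, ∏ i ∈ A3 j, (1 - q i) = (1 - p) ^ Δ * (1 - p) * Fintype.card W := by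
    have : ∀ v, ∏ i ∈ A3 v, (1 - q i) = (1 - p) ^ Δ * (1 - p) := by
      intro v
      simp only [hA3, hprod, hNbc, prod_singleton]
      rw [← pow_add, ← pow_succ]
      congr 1
      have := hdeg v
      simp only [hNb]
      omega
    simp_rw [this]
    simp [mul_comm]
  have m4 : ∑ j, ∏ i ∈ A4 j, (1 - q i) ≤ ((1 - p) ^ Δ) ^ 2 * ((∑ v, #(Nb v) : ℕ)
      + 2 * p * ∑ b : W × W with H.Adj b.1 b.2, (#{s | H.Adj b.1 s ∧ H.Adj b.2 s} : ℝ)) := by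
    have hE : ((∑ v, #(Nb v) : ℕ) : ℝ) = ∑ b : W × W with H.Adj b.1 b.2, (1 : ℝ) := by
      rw [sum_filter, Fintype.sum_prod_type]
      push_cast
      exact sum_congr rfl fun v _ => by rw [sum_boole]
    rw [hE, mul_sum, ← sum_add_distrib, mul_sum, sum_subtype (p := fun b : W × W => H.Adj b.1 b.2)
      _ (fun b => by simp)]
    refine sum_le_sum fun b _ => ?_
    simp only [hA4, hprod]
    rw [prod_pair b.2.ne]
    exact one_sub_pow_card_union_le H hdeg hp0 hp1 hpΔ b.2
  -- `K` avoids the neighbours of every picked vertex, not only of those kept in `I`; survival is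
  -- then an avoidance event with explicit probability.
  refine ⟨univ.filter fun v => Sum.inl v ∈ X ∧ ∀ w, H.Adj v w → Sum.inl w ∉ X,
    univ.filter fun v => Disjoint (A3 v) X, ?_, ?_, ?_, ?_, ?_⟩
  · intro v hv w hw _ hvw
    exact (mem_filter.1 hv).2.2 w hvw (mem_filter.1 hw).2.1
  · intro v hv
    simp only [hA3, mem_filter, mem_univ, true_and, disjoint_disjSum_iff, mem_insert] at hv ⊢
    refine ⟨fun h => hv.1 v (Or.inl rfl) h.1, fun u hu huv => hv.1 u (Or.inr ?_) hu.1⟩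
    simpa [hNb] using huv.symm
  · have hI : avoidCount A1 X - avoidCount A2 X
        = #{v | Sum.inl v ∈ X ∧ ∀ w, H.Adj v w → Sum.inl w ∉ X} := by
      rw [avoidCount, avoidCount, ← sum_sub_distrib, ← sum_boole]
      refine sum_congr rfl fun v _ => ?_
      have e1 : Disjoint (A1 v) X ↔ ∀ w, H.Adj v w → Sum.inl w ∉ X := by
        simp only [hA1, disjoint_disjSum_iff]
        simp [hNb]
      have e2 : Disjoint (A2 v) X ↔ Sum.inl v ∉ X ∧ ∀ w, H.Adj v w → Sum.inl w ∉ X := by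
        simp only [hA2, disjoint_disjSum_iff]
        simp [hNb]
      by_cases h1 : Sum.inl v ∈ X <;> by_cases h2 : ∀ w, H.Adj v w → Sum.inl w ∉ X <;>
        simp only [e1, e2, h1, h2, not_true, not_false_eq_true, true_and, false_and, if_false,
          sub_zero, sub_self]
    rw [← hI]
    have h1 := (abs_le.1 d1).1
    have h2 := (abs_le.1 d2).2
    linarith
  · rw [m3, avoidCount_eq_card] at d3
    exact d3
  · have hK : (#{b : W × W | H.Adj b.1 b.2 ∧ b.1 ∈ ({v | Disjoint (A3 v) X} : Finset W)
        ∧ b.2 ∈ ({v | Disjoint (A3 v) X} : Finset W)} : ℝ) = avoidCount A4 X := by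
      rw [avoidCount, ← sum_boole, ← sum_filter_add_sum_filter_not _
        (fun b : W × W => H.Adj b.1 b.2), sum_subtype (p := fun b : W × W => H.Adj b.1 b.2)
        _ (fun b => by simp)]
      rw [sum_eq_zero (s := filter _ _), add_zero]
      · refine sum_congr rfl fun b _ => ?_
        congr 1
        simp only [hA3, hA4, disjoint_disjSum_iff, mem_union, mem_insert, mem_singleton,
          mem_filter, mem_univ, true_and, b.2, eq_iff_iff, or_imp, forall_and, forall_eq]
        tauto
      · intro b hb
        rw [if_neg fun h => (mem_filter.1 hb).2 h.1]
    rw [hK]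
    have h4 := (abs_le.1 d4).2
    linarith

open Classical in
/-- The ordered pairs of adjacent vertices of `G` inside `U`. -/
noncomputable def adjPairs {V : Type*} (G : SimpleGraph V) (U : Finset V) : Finset (V × V) :=
  {b ∈ U ×ˢ U | G.Adj b.1 b.2}

/-- `exists_nibble_approx` in terms of the average and the maximum degree. -/
theorem exists_nibble_approx_of_maxDeg {W : Type*} [Fintype W] (H : SimpleGraph W)
    {p : ℝ} (hp0 : 0 ≤ p) (hp1 : p ≤ 1) (hpΔ : p * maxDeg H ≤ 1 / 2) {η : ℝ} (hη0 : 0 ≤ η)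
    (hη : 32 * Fintype.card W * ((maxDeg H : ℝ) + 1) ^ 4 ≤ η ^ 2) :
    ∃ I K : Finset W, H.IsIndepSet (I : Set W) ∧ (∀ v ∈ K, v ∉ I ∧ ∀ u ∈ I, ¬ H.Adj u v) ∧
      p * Fintype.card W - p ^ 2 * (avgDegree H * Fintype.card W) - 2 * η ≤ #I ∧
      |(#K : ℝ) - (1 - p) ^ maxDeg H * (1 - p) * Fintype.card W| ≤ η ∧
      (#(adjPairs H K) : ℝ) ≤ ((1 - p) ^ maxDeg H) ^ 2
        * (avgDegree H * Fintype.card W + 2 * p * codegreeSum H) + η := by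
  classical
  obtain ⟨I, K, hI, hIK, h1, h2, h3⟩ :=
    exists_nibble_approx H (card_adj_le_maxDeg H) hp0 hp1 hpΔ hη0 hη
  have hsum : ((∑ v, #{w | H.Adj v w} : ℕ) : ℝ) = avgDegree H * Fintype.card W := by
    rw [avgDegree]
    rcases isEmpty_or_nonempty W with hW | hW
    · simp
    · have hc : (Fintype.card W : ℝ) ≠ 0 := by exact_mod_cast Fintype.card_ne_zero
      rw [div_mul_cancel₀ _ hc]
      push_cast
      refine sum_congr rfl fun v _ => ?_
      rw [← SimpleGraph.card_neighborFinset_eq_degree]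
      congr 2
      ext w
      simp
  have hK : #(adjPairs H K) = #{b : W × W | H.Adj b.1 b.2 ∧ b.1 ∈ K ∧ b.2 ∈ K} := by
    congr 1
    ext b
    simp [adjPairs, and_comm]
  refine ⟨I, K, hI, hIK, ?_, h2, ?_⟩
  · rw [← hsum]
    convert h1
  · rw [← hsum, hK, codegreeSum]
    convert h3

end RandomNibble

/-! ### Induced subgraphs -/

section InducedOn

open Finset

open Classical in
lemma degree_inducedOn {V : Type*} (G : SimpleGraph V) (U : Finset V) (v : (U : Set V))
    [Fintype ((inducedOn G U).neighborSet v)] :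
    (inducedOn G U).degree v = #{w ∈ U | G.Adj v w} := by
  rw [← SimpleGraph.card_neighborFinset_eq_degree, ← card_map (Function.Embedding.subtype _)]
  congr 1
  ext w
  simp [and_comm]

open Classical in
lemma card_adjPairs {V : Type*} (G : SimpleGraph V) (U : Finset V) :
    #(adjPairs G U) = ∑ v ∈ U, #{w ∈ U | G.Adj v w} := by
  rw [adjPairs, card_filter, sum_product]
  exact sum_congr rfl fun v _ => (card_filter _ _).symm

lemma avgDegree_inducedOn {V : Type*} (G : SimpleGraph V) (U : Finset V) :
    avgDegree (inducedOn G U) = #(adjPairs G U) / #U := by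
  classical
  rw [avgDegree, card_adjPairs]
  congr 1
  · push_cast
    rw [← sum_coe_sort U]
    exact sum_congr rfl fun v _ => by rw [degree_inducedOn]
  · simp

lemma avgDegree_inducedOn_nonneg {V : Type*} (G : SimpleGraph V) (U : Finset V) :
    0 ≤ avgDegree (inducedOn G U) := by
  rw [avgDegree_inducedOn]; positivity

lemma avgDegree_inducedOn_mul_card {V : Type*} (G : SimpleGraph V) (U : Finset V) :
    avgDegree (inducedOn G U) * #U = #(adjPairs G U) := by
  rw [avgDegree_inducedOn]
  rcases U.eq_empty_or_nonempty with rfl | h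
  · simp [adjPairs]
  · have : (0 : ℝ) < #U := by exact_mod_cast h.card_pos
    field_simp

lemma degree_le_maxDeg {V : Type*} [Fintype V] (G : SimpleGraph V) (v : V)
    [Fintype (G.neighborSet v)] : G.degree v ≤ maxDeg G := by
  classical
  rw [maxDeg]
  convert G.degree_le_maxDegree v

lemma avgDegree_le_maxDeg {V : Type*} [Fintype V] (G : SimpleGraph V) :
    avgDegree G ≤ maxDeg G := by
  classical
  rw [avgDegree]
  refine div_le_of_le_mul₀ (by positivity) (by positivity) ?_
  calc ∑ v : V, (G.degree v : ℝ) ≤ ∑ v : V, (maxDeg G : ℝ) :=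
        sum_le_sum fun v _ => by exact_mod_cast degree_le_maxDeg G v
    _ = _ := by simp [mul_comm]

lemma free_inducedOn {V A : Type*} {G : SimpleGraph V} {F : SimpleGraph A} (h : F.Free G)
    (U : Finset V) : F.Free (inducedOn G U) := fun hc =>
  h (hc.trans (SimpleGraph.Embedding.induce (U : Set V)).toCopy.isContained)

lemma card_adjPairs_map_subtype {V : Type*} (G : SimpleGraph V) (U : Finset V)
    (K : Finset (U : Set V)) :
    #(adjPairs G (K.map (Function.Embedding.subtype _))) = #(adjPairs (inducedOn G U) K) := by
  classical
  rw [card_adjPairs, card_adjPairs, sum_map]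
  refine sum_congr rfl fun v _ => ?_
  rw [filter_map, card_map]
  rfl

end InducedOn

/-! ### Existence of a nibble -/

section Existence

open Finset Filter

/-- Transfer of `exists_nibble_approx` to an induced subgraph. -/
lemma exists_nibble_approx_inducedOn {V : Type*} (G : SimpleGraph V) (U : Finset V)
    {p : ℝ} (hp0 : 0 ≤ p) (hp1 : p ≤ 1) (hpΔ : p * maxDeg (inducedOn G U) ≤ 1 / 2) {η : ℝ}
    (hη0 : 0 ≤ η) (hη : 32 * #U * ((maxDeg (inducedOn G U) : ℝ) + 1) ^ 4 ≤ η ^ 2) :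
    ∃ I K : Finset V, I ⊆ U ∧ G.IsIndepSet (I : Set V) ∧ K ⊆ U ∧
      (∀ v ∈ K, v ∉ I ∧ ∀ u ∈ I, ¬ G.Adj u v) ∧
      p * #U - p ^ 2 * (avgDegree (inducedOn G U) * #U) - 2 * η ≤ #I ∧
      |(#K : ℝ) - (1 - p) ^ maxDeg (inducedOn G U) * (1 - p) * #U| ≤ η ∧
      (#(adjPairs G K) : ℝ) ≤ ((1 - p) ^ maxDeg (inducedOn G U)) ^ 2
        * (avgDegree (inducedOn G U) * #U + 2 * p * codegreeSum (inducedOn G U)) + η := by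
  classical
  have hcard : Fintype.card (U : Set V) = #U := by simp
  obtain ⟨I, K, hI, hIK, h1, h2, h3⟩ :=
    exists_nibble_approx_of_maxDeg (inducedOn G U) hp0 hp1 hpΔ hη0 (by rw [hcard]; exact hη)
  rw [hcard] at h1 h2 h3
  refine ⟨I.map (Function.Embedding.subtype _), K.map (Function.Embedding.subtype _),
    ?_, ?_, ?_, ?_, ?_, ?_, ?_⟩
  · intro v hv
    obtain ⟨w, _, rfl⟩ := mem_map.1 hv
    exact w.2
  · intro v hv w hw hne hvw
    obtain ⟨v, hvI, rfl⟩ := mem_map.1 hv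
    obtain ⟨w, hwI, rfl⟩ := mem_map.1 hw
    exact hI hvI hwI (fun h => hne (congrArg _ h)) hvw
  · intro v hv
    obtain ⟨w, _, rfl⟩ := mem_map.1 hv
    exact w.2
  · intro v hv
    obtain ⟨v, hvK, rfl⟩ := mem_map.1 hv
    refine ⟨fun h => (hIK v hvK).1 (by simpa using h), fun u hu huv => ?_⟩
    obtain ⟨u, huI, rfl⟩ := mem_map.1 hu
    exact (hIK v hvK).2 u huI huv
  · rwa [card_map]
  · rwa [card_map]
  · rwa [card_adjPairs_map_subtype]

/-- The arithmetic behind the choice of the parameters of a nibble. -/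
lemma nibble_arith {N D p g b T δ i k e : ℝ} {κ : ℝ} (hN : 0 < N) (hD : 1 ≤ D)
    (hκ0 : 0 < κ) (hκ1 : κ ≤ 1 / 10) (hp : p * D = κ) (hpb : p ≤ b / 2) (hp0 : 0 < p)
    (hb0 : 0 < b) (hb1 : b ≤ 1 / 2) (hg : 1 / 2 ≤ g) (hT : 2 * p * T ≤ b / 2 * (N * D))
    (hδ1 : 2 * δ ≤ κ * p) (hδ2 : δ ≤ b / 8)
    (hi : p * N - p ^ 2 * (D * N) - 2 * (δ * N) ≤ i)
    (hk : |k - g * (1 - p) * N| ≤ δ * N)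
    (he : e ≤ g ^ 2 * (D * N + 2 * p * T) + δ * N) :
    (1 - 2 * κ) * N * p ≤ i ∧ (1 - b) * (g * (1 - p) * N) ≤ k ∧
      k ≤ (1 + b) * (g * (1 - p) * N) ∧ e / k ≤ (1 + 4 * b) * g * D := by
  have hp1 : p ≤ 1 / 4 := by linarith
  have hgp : 3 / 8 ≤ g * (1 - p) := by nlinarith
  have hδN : δ * N ≤ b / 2 * (g * (1 - p) * N) := by
    have : δ ≤ b / 2 * (g * (1 - p)) := by nlinarith
    calc δ * N ≤ b / 2 * (g * (1 - p)) * N := by gcongr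
      _ = _ := by ring
  have hμ : 0 < g * (1 - p) * N := by positivity
  obtain ⟨hk1, hk2⟩ := abs_le.1 hk
  have hklow : (1 - b / 2) * (g * (1 - p) * N) ≤ k := by linarith
  have hk0 : 0 < k := lt_of_lt_of_le (by
    have : 0 < 1 - b / 2 := by linarith
    positivity) hklow
  refine ⟨?_, ?_, ?_, ?_⟩
  · refine le_trans ?_ hi
    have h1 : p ^ 2 * (D * N) = κ * p * N := by rw [← hp]; ring
    have h2 : 2 * (δ * N) ≤ κ * p * N := by
      calc 2 * (δ * N) = 2 * δ * N := by ring
        _ ≤ _ := by gcongr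
    rw [h1]
    linarith
  · have : 0 ≤ b / 2 * (g * (1 - p) * N) := by positivity
    linarith
  · have : 0 ≤ b / 2 * (g * (1 - p) * N) := by positivity
    linarith
  · rw [div_le_iff₀ hk0]
    have h1 : δ * N ≤ b / 2 * (g ^ 2 * (N * D)) := by
      have : δ ≤ b / 2 * (g ^ 2 * D) := by
        have hg2 : 1 / 4 ≤ g ^ 2 := by nlinarith
        have : 1 / 4 ≤ g ^ 2 * D := by nlinarith
        nlinarith
      calc δ * N ≤ b / 2 * (g ^ 2 * D) * N := by gcongr
        _ = _ := by ring
    have h2 : e ≤ (1 + b) * (g ^ 2 * (N * D)) := by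
      refine he.trans ?_
      have : g ^ 2 * (2 * p * T) ≤ g ^ 2 * (b / 2 * (N * D)) := by gcongr
      linarith
    -- The edges cost `1 + b` and the order costs `1 - b`; the constant 4 works precisely because `b
    -- ≤ 1 / 2`.
    have h3 : 1 + b ≤ (1 + 4 * b) * ((1 - b / 2) * (1 - p)) := by
      have h4 : 1 - b ≤ (1 - b / 2) * (1 - p) := by nlinarith
      have h5 : 1 + b ≤ (1 + 4 * b) * (1 - b) := by nlinarith
      have h6 : (1 + 4 * b) * (1 - b) ≤ (1 + 4 * b) * ((1 - b / 2) * (1 - p)) := by gcongr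
      linarith
    calc e ≤ (1 + b) * (g ^ 2 * (N * D)) := h2
      _ ≤ (1 + 4 * b) * ((1 - b / 2) * (1 - p)) * (g ^ 2 * (N * D)) := by gcongr
      _ = (1 + 4 * b) * g * D * ((1 - b / 2) * (g * (1 - p) * N)) := by ring
      _ ≤ (1 + 4 * b) * g * D * k := by gcongr

/-- The error caused by the triangles in a nibble. -/
lemma triangle_error_le {t : ℕ} (ht : 1 ≤ t) {N D Δ p κ C : ℝ} (hN : 0 ≤ N) (hD : 1 ≤ D)
    (hΔ0 : 0 ≤ Δ) (hC : 0 < C) (hΔ : Δ ≤ (1 + κ) * D) (hκ0 : 0 < κ) (hκ1 : κ ≤ 1 / 10)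
    (hp : p * D = κ) (hp0 : 0 < p)
    (h : D ^ (-(19 * (1 / (20 * (t : ℝ) ^ 2)))) ≤ 1 / (16 * κ * C)) :
    2 * p * (C * (N * Δ ^ (2 - 1 / (t : ℝ) ^ 2)))
      ≤ D ^ (-(1 / (20 * (t : ℝ) ^ 2))) / 2 * (N * D) := by
  have hD0 : 0 < D := by linarith
  have htR : (1 : ℝ) ≤ t := by exact_mod_cast ht
  have ht2 : (1 : ℝ) ≤ (t : ℝ) ^ 2 := one_le_pow₀ htR
  set a : ℝ := 1 / (20 * (t : ℝ) ^ 2) with ha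
  have hs : 1 / (t : ℝ) ^ 2 = 20 * a := by rw [ha]; field_simp
  have ha0 : 0 < a := by positivity
  have hs1 : 1 / (t : ℝ) ^ 2 ≤ 1 := (div_le_one (by positivity)).2 ht2
  rw [hs] at hs1 ⊢
  have e1 : Δ ^ (2 - 20 * a) ≤ 4 * D ^ (2 - 20 * a) := by
    calc Δ ^ (2 - 20 * a) ≤ (2 * D) ^ (2 - 20 * a) :=
          Real.rpow_le_rpow hΔ0 (by nlinarith) (by linarith)
      _ = 2 ^ (2 - 20 * a) * D ^ (2 - 20 * a) := Real.mul_rpow (by norm_num) hD0.le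
      _ ≤ 2 ^ (2 : ℝ) * D ^ (2 - 20 * a) := by
          gcongr
          · norm_num
          · linarith
      _ = _ := by norm_num
  -- Of the saving `D ^ (-20 a)`, one part `D ^ (-a)` is `β`, and the rest absorbs all constants.
  have e2 : D ^ (2 - 20 * a) = D ^ (-(19 * a)) * D ^ (-a) * D * D := by
    rw [← Real.rpow_add hD0, mul_assoc, ← sq, ← Real.rpow_natCast, ← Real.rpow_add hD0]
    congr 1
    push_cast
    ring
  have e3 : D ^ (-(19 * a)) * (16 * κ * C) ≤ 1 := by
    rwa [le_div_iff₀ (by positivity)] at h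
  calc 2 * p * (C * (N * Δ ^ (2 - 20 * a)))
      ≤ 2 * p * (C * (N * (4 * (D ^ (-(19 * a)) * D ^ (-a) * D * D)))) := by
        rw [← e2]
        gcongr
    _ = D ^ (-(19 * a)) * (16 * (p * D) * C) * (D ^ (-a) / 2 * (N * D)) := by ring
    _ ≤ 1 * (D ^ (-a) / 2 * (N * D)) := by
        rw [hp]
        gcongr
    _ = _ := one_mul _

/-- The sizes of the parameters of a nibble. -/
lemma nibble_parameters {κ D M a δ p : ℝ} {Δ : ℕ} (hκ0 : 0 < κ) (hκ1 : κ ≤ 1 / 10)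
    (ha1 : a ≤ 1) (hM : 1 ≤ M) (hδ : δ = κ ^ 2 / (8 * M)) (hD1 : 1 ≤ D) (hDM : D ≤ M)
    (hp : p = κ / D) (hΔ : (Δ : ℝ) ≤ (1 + κ) * D) :
    0 < p ∧ p * D = κ ∧ p ≤ D ^ (-a) / 2 ∧ p * Δ ≤ 1 / 2 ∧ 1 / 2 ≤ (1 - p) ^ Δ ∧
      2 * δ ≤ κ * p ∧ δ ≤ D ^ (-a) / 8 := by
  have hD0 : 0 < D := by linarith
  have hM0 : 0 < M := by linarith
  have hp0 : 0 < p := by rw [hp]; positivity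
  have hpD : p * D = κ := by rw [hp]; exact div_mul_cancel₀ _ hD0.ne'
  have hpM : κ / M ≤ p := by rw [hp]; gcongr
  have hDa : D⁻¹ ≤ D ^ (-a) := by
    rw [← Real.rpow_neg_one]
    exact Real.rpow_le_rpow_of_exponent_le hD1 (by linarith)
  have hbM : M⁻¹ ≤ D ^ (-a) := (inv_anti₀ hD0 hDM).trans hDa
  have hpΔ : p * Δ ≤ 11 / 100 := by
    calc p * Δ ≤ p * ((1 + κ) * D) := by gcongr
      _ = (1 + κ) * κ := by rw [← hpD]; ring
      _ ≤ 11 / 100 := by nlinarith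
  have hp1 : p ≤ 1 := by
    rw [hp, div_le_one hD0]
    linarith
  have hδM : δ = κ * (κ / M) / 8 := by
    rw [hδ]
    field_simp
  have hκM : 0 ≤ κ * (κ / M) := by positivity
  refine ⟨hp0, hpD, ?_, by linarith, ?_, ?_, ?_⟩
  · rw [hp, div_eq_mul_inv]
    have : 0 < D⁻¹ := by positivity
    nlinarith
  · have := one_add_mul_le_pow (a := -p) (by linarith) Δ
    rw [← sub_eq_add_neg] at this
    linarith
  · have : κ * (κ / M) ≤ κ * p := by gcongr
    linarith
  · have h1 : κ * (κ / M) ≤ 1 * D ^ (-a) := by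
      have : κ / M ≤ D ^ (-a) := by
        refine le_trans ?_ hbM
        rw [div_eq_mul_inv]
        have : 0 < M⁻¹ := by positivity
        nlinarith
      have hκ1' : κ ≤ 1 := by linarith
      gcongr
    linarith

/-- A nibble as required exists in every large graph without a `K_{t,t,t}` whose average degree is
large and whose maximum degree is not much larger. -/
theorem exists_isNibbleOutcome (t : ℕ) (ht : 1 ≤ t) {κ : ℝ} (hκ0 : 0 < κ) (hκ1 : κ ≤ 1 / 10) :
    ∃ D₀ : ℝ, ∀ M : ℝ, ∃ N₀ : ℕ, ∀ (V : Type*) [Fintype V] (G : SimpleGraph V) (U : Finset V),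
      (SimpleGraph.completeEquipartiteGraph 3 t).Free G → N₀ ≤ #U →
      D₀ ≤ avgDegree (inducedOn G U) → avgDegree (inducedOn G U) ≤ M →
      (maxDeg (inducedOn G U) : ℝ) ≤ (1 + κ) * avgDegree (inducedOn G U) →
      ∃ I K : Finset V, IsNibbleOutcome t κ G U I K := by
  classical
  obtain ⟨C, hC, hCT⟩ := exists_codegreeSum_le t ht
  have htR : (1 : ℝ) ≤ t := by exact_mod_cast ht
  have ht2 : (1 : ℝ) ≤ (t : ℝ) ^ 2 := one_le_pow₀ htR
  have ha0 : 0 < 1 / (20 * (t : ℝ) ^ 2) := by positivity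
  have ha1 : 1 / (20 * (t : ℝ) ^ 2) ≤ 1 := by
    rw [div_le_one (by positivity)]
    linarith
  have ev1 : ∀ᶠ D : ℝ in atTop, D ^ (-(1 / (20 * (t : ℝ) ^ 2))) ≤ 1 / 2 :=
    (tendsto_rpow_neg_atTop ha0).eventually_le_const (by norm_num)
  have ev2 : ∀ᶠ D : ℝ in atTop, D ^ (-(19 * (1 / (20 * (t : ℝ) ^ 2)))) ≤ 1 / (16 * κ * C) :=
    (tendsto_rpow_neg_atTop (by positivity)).eventually_le_const (by positivity)
  obtain ⟨D₀, hD₀⟩ := eventually_atTop.1 (ev1.and (ev2.and (eventually_ge_atTop (1 : ℝ))))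
  refine ⟨D₀, fun M => ?_⟩
  obtain ⟨M', hM'⟩ : ∃ M', M' = max M 1 := ⟨_, rfl⟩
  have hM1 : 1 ≤ M' := hM' ▸ le_max_right _ _
  obtain ⟨δ, hδ⟩ : ∃ δ, δ = κ ^ 2 / (8 * M') := ⟨_, rfl⟩
  have hδ0 : 0 < δ := by rw [hδ]; positivity
  -- The allowed error `η = δ #U` has a square quadratic in `#U`, against a variance bound linear in
  -- `#U`; here `Δ ≤ 2 M'`.
  refine ⟨max 1 ⌈32 * (2 * M' + 1) ^ 4 / δ ^ 2⌉₊, fun V _ G U hfree hN hD hDM hΔ => ?_⟩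
  have hU1 : 1 ≤ #U := (le_max_left _ _).trans hN
  have hN0 : (0 : ℝ) < #U := by exact_mod_cast hU1
  have hDΔ := avgDegree_le_maxDeg (inducedOn G U)
  have hcod := hCT _ (inducedOn G U)
  have happrox := fun p => exists_nibble_approx_inducedOn G U (p := p)
  simp only [IsNibbleOutcome]
  generalize avgDegree (inducedOn G U) = D at *
  generalize maxDeg (inducedOn G U) = Δ at *
  generalize codegreeSum (inducedOn G U) = T at *
  obtain ⟨hb1, hT1, hD1⟩ := hD₀ D hD
  have hD0 : 0 < D := by linarith
  have hΔ1 : 1 ≤ Δ := by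
    have : (1 : ℝ) ≤ Δ := hD1.trans hDΔ
    exact_mod_cast this
  have hDM' : D ≤ M' := hDM.trans (hM' ▸ le_max_left _ _)
  obtain ⟨hp0, hpD, hpb, hpΔ, hγ, hδ1, hδ2⟩ :=
    nibble_parameters hκ0 hκ1 ha1 hM1 hδ hD1 hDM' rfl hΔ
  have hη : 32 * #U * ((Δ : ℝ) + 1) ^ 4 ≤ (δ * #U) ^ 2 := by
    have h1 : 32 * (2 * M' + 1) ^ 4 / δ ^ 2 ≤ #U :=
      (Nat.le_ceil _).trans (by exact_mod_cast (le_max_right _ _).trans hN)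
    rw [div_le_iff₀ (by positivity)] at h1
    have h2 : (Δ : ℝ) ≤ 2 * M' := by nlinarith
    calc 32 * #U * ((Δ : ℝ) + 1) ^ 4 ≤ 32 * #U * (2 * M' + 1) ^ 4 := by gcongr
      _ = #U * (32 * (2 * M' + 1) ^ 4) := by ring
      _ ≤ #U * (#U * δ ^ 2) := by gcongr
      _ = _ := by ring
  have hT := hcod hΔ1 (free_inducedOn hfree U)
  rw [show Fintype.card (U : Set V) = #U by simp] at hT
  obtain ⟨I, K, hIU, hI, hKU, hIK, h1, h2, h3⟩ := happrox (κ / D) hp0.le (by linarith) hpΔ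
    (by positivity) hη
  have hTb : 2 * (κ / D) * T ≤ D ^ (-(1 / (20 * (t : ℝ) ^ 2))) / 2 * (#U * D) :=
    (mul_le_mul_of_nonneg_left hT (by positivity)).trans
      (triangle_error_le ht hN0.le hD1 (Nat.cast_nonneg Δ) hC hΔ hκ0 hκ1 hpD hp0 hT1)
  obtain ⟨r1, r2, r3, r4⟩ := nibble_arith hN0 hD1 hκ0 hκ1 hpD hpb hp0 (by positivity) hb1 hγ hTb
    hδ1 hδ2 h1 h2 h3
  refine ⟨I, K, hIU, hI, hKU, hIK, r1, r2, r3, ?_⟩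
  rw [avgDegree_inducedOn G K]
  exact r4

end Existence

/-! ### The steps of the procedure -/

section Steps

open Finset

open Classical in
lemma card_adjPairs_erase {V : Type*} (G : SimpleGraph V) {U : Finset V} {v : V} (hv : v ∈ U) :
    #(adjPairs G (U.erase v)) + 2 * #{w ∈ U | G.Adj v w} = #(adjPairs G U) := by
  rw [card_adjPairs, card_adjPairs, ← sum_erase_add _ _ hv]
  have h1 : ∀ w ∈ U.erase v, #{x ∈ U | G.Adj w x}
      = #{x ∈ U.erase v | G.Adj w x} + if G.Adj v w then 1 else 0 := by
    intro w _
    rw [← insert_erase hv, filter_insert, erase_insert (notMem_erase v U)]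
    by_cases h : G.Adj w v
    · rw [if_pos h, if_pos h.symm, card_insert_of_notMem (by simp)]
    · rw [if_neg h, if_neg fun h' => h h'.symm, add_zero]
  have h2 : ∑ w ∈ U.erase v, (if G.Adj v w then 1 else 0) = #{w ∈ U | G.Adj v w} := by
    rw [← card_filter, filter_erase, erase_eq_of_notMem]
    simp
  rw [sum_congr rfl h1, sum_add_distrib, h2]
  ring

/-- The numerical effect of a cleaning step: `N`, `D`, `R` become `N - 1`, `D'`, `R N / (N - 1)`. -/
lemma cleaning_arith {κ N D D' R d n H : ℝ} (hκ : 0 ≤ κ) (hN : 2 ≤ N) (hD : 0 ≤ D)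
    (hD' : D' * (N - 1) ≤ N * D - 2 * ((1 + κ) * D)) (hR : 1 ≤ R) (hn : 0 ≤ n) (hH : 0 ≤ H)
    (h : n * D * R ^ (2 * κ) * H ≤ N * d) :
    n * D' * (R * (N / (N - 1))) ^ (2 * κ) * H ≤ (N - 1) * d ∧ D' ≤ D := by
  have hN1 : 0 < N - 1 := by linarith
  obtain ⟨x, hx⟩ : ∃ x, x = 1 / (N - 1) := ⟨_, rfl⟩
  have hx0 : 0 < x := by rw [hx]; positivity
  have hxN : x * (N - 1) = 1 := by rw [hx]; field_simp
  have hr : N / (N - 1) = 1 + x := by rw [hx]; field_simp; ring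
  have hr0 : 0 < 1 + x := by linarith
  have hD2 : D' ≤ D * (1 - (1 + 2 * κ) * x) := by
    have h1 : D' * (N - 1) * x ≤ (N * D - 2 * ((1 + κ) * D)) * x := by gcongr
    have h2 : D' * (N - 1) * x = D' := by rw [mul_assoc, mul_comm (N - 1), hxN, mul_one]
    have h3 : (N * D - 2 * ((1 + κ) * D)) * x = D * (x * (N - 1) - (1 + 2 * κ) * x) := by ring
    rw [h2, h3, hxN] at h1
    exact h1
  -- `D` falls by `exp (-(1 + 2 κ) x)` while `N` falls by `1 / (1 + x)`. The surplus `2 κ x` pays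
  -- for the growth of `R ^ (2 κ)`.
  have hD3 : D' ≤ D * Real.exp (-((1 + 2 * κ) * x)) := by
    refine hD2.trans (mul_le_mul_of_nonneg_left ?_ hD)
    have := Real.add_one_le_exp (-((1 + 2 * κ) * x))
    linarith
  have hpow : (1 + x) * (1 + x) ^ (2 * κ) ≤ Real.exp ((1 + 2 * κ) * x) := by
    have h1 : 1 + x ≤ Real.exp x := by linarith [Real.add_one_le_exp x]
    calc (1 + x) * (1 + x) ^ (2 * κ) ≤ Real.exp x * Real.exp x ^ (2 * κ) := by gcongr
      _ = Real.exp ((1 + 2 * κ) * x) := by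
          rw [← Real.exp_mul, ← Real.exp_add]
          ring_nf
  have hD4 : D' * ((1 + x) * (1 + x) ^ (2 * κ)) ≤ D := by
    calc D' * ((1 + x) * (1 + x) ^ (2 * κ))
        ≤ D * Real.exp (-((1 + 2 * κ) * x)) * ((1 + x) * (1 + x) ^ (2 * κ)) := by gcongr
      _ ≤ D * Real.exp (-((1 + 2 * κ) * x)) * Real.exp ((1 + 2 * κ) * x) := by gcongr
      _ = D := by rw [mul_assoc, ← Real.exp_add, neg_add_cancel, Real.exp_zero, mul_one]
  constructor
  · rw [hr, Real.mul_rpow (by linarith) hr0.le]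
    have hNr : (1 + x) * (N - 1) = N := by linarith
    refine le_of_mul_le_mul_left ?_ hr0
    calc (1 + x) * (n * D' * (R ^ (2 * κ) * (1 + x) ^ (2 * κ)) * H)
        = n * (D' * ((1 + x) * (1 + x) ^ (2 * κ))) * R ^ (2 * κ) * H := by ring
      _ ≤ n * D * R ^ (2 * κ) * H := by gcongr
      _ ≤ N * d := h
      _ = (1 + x) * ((N - 1) * d) := by rw [← mul_assoc, hNr]
  · refine hD2.trans ?_
    have : 0 ≤ D * ((1 + 2 * κ) * x) := by positivity
    linarith

lemma exp_neg_div_le_one_sub {p : ℝ} (hp : p < 1) : Real.exp (-(p / (1 - p))) ≤ 1 - p := by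
  have h0 : 0 < 1 - p := by linarith
  have h1 := Real.add_one_le_exp (p / (1 - p))
  have h2 : p / (1 - p) + 1 = (1 - p)⁻¹ := by field_simp; ring
  rw [h2] at h1
  rw [Real.exp_neg]
  exact inv_le_of_inv_le₀ h0 h1

lemma exp_neg_two_mul_le_one_sub {x : ℝ} (hx0 : 0 ≤ x) (hx : x ≤ 1 / 2) :
    Real.exp (-(2 * x)) ≤ 1 - x := by
  refine le_trans (Real.exp_le_exp.2 (neg_le_neg ?_)) (exp_neg_div_le_one_sub (by linarith))
  rw [div_le_iff₀ (by linarith)]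
  nlinarith

/-- The numerical effect of a nibble step. -/
lemma nibble_step_arith {κ D p b β : ℝ} {Δ : ℕ} (hκ0 : 0 < κ) (hκ1 : κ ≤ 1 / 10) (hD : 0 < D)
    (hΔ1 : D ≤ Δ) (hΔ2 : (Δ : ℝ) ≤ (1 + κ) * D) (hp : p = κ / D) (hpb : p ≤ b) (hβ0 : 0 ≤ β)
    (hβ : β ≤ b) (hb : 4 * b ≤ κ) :
    0 < (1 - p) ^ Δ ∧ Real.exp (-(κ * (1 + κ) + 5 * b)) ≤ (1 - β) * ((1 - p) ^ Δ * (1 - p)) ∧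
      (1 + 4 * β) * (1 - p) ^ Δ ≤ 1 ∧
      (1 + 4 * β) * (1 - p) ^ Δ * (1 - 6 * b) ≤ (1 - β) * ((1 - p) ^ Δ * (1 - p)) := by
  have hp0 : 0 < p := by rw [hp]; positivity
  have hpD : p * D = κ := by rw [hp]; exact div_mul_cancel₀ _ hD.ne'
  have hb1 : b ≤ 1 / 40 := by linarith
  have hγ0 : 0 < (1 - p) ^ Δ := pow_pos (by linarith) _
  have hpΔ : p * Δ ≤ κ * (1 + κ) := by
    calc p * Δ ≤ p * ((1 + κ) * D) := by gcongr
      _ = κ * (1 + κ) := by rw [← hpD]; ring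
  have hγ : Real.exp (-(κ * (1 + κ) + b)) ≤ (1 - p) ^ Δ := by
    calc Real.exp (-(κ * (1 + κ) + b)) ≤ Real.exp (-(p / (1 - p))) ^ Δ := by
          rw [← Real.exp_nat_mul]
          refine Real.exp_le_exp.2 ?_
          have h1 : (Δ : ℝ) * (p / (1 - p)) ≤ κ * (1 + κ) + b := by
            rw [mul_div_assoc', div_le_iff₀ (by linarith)]
            have h2 : κ * (1 + κ) + b ≤ 1 := by nlinarith
            have h3 : (κ * (1 + κ) + b) * p ≤ 1 * p := by gcongr
            linarith
          linarith
      _ ≤ (1 - p) ^ Δ := by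
          gcongr
          exact exp_neg_div_le_one_sub (by linarith)
  refine ⟨hγ0, ?_, ?_, ?_⟩
  · have h1 : Real.exp (-(2 * b)) ≤ 1 - β :=
      (exp_neg_two_mul_le_one_sub (by linarith) (by linarith)).trans (by linarith)
    have h2 : Real.exp (-(2 * b)) ≤ 1 - p :=
      (exp_neg_two_mul_le_one_sub (by linarith) (by linarith)).trans (by linarith)
    calc Real.exp (-(κ * (1 + κ) + 5 * b))
        = Real.exp (-(2 * b)) * (Real.exp (-(κ * (1 + κ) + b)) * Real.exp (-(2 * b))) := by
          rw [← Real.exp_add, ← Real.exp_add]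
          ring_nf
      _ ≤ (1 - β) * ((1 - p) ^ Δ * (1 - p)) := by
          have : 0 ≤ 1 - β := by linarith
          gcongr
  · have h1 : (1 - p) ^ Δ ≤ Real.exp (-κ) := by
      calc (1 - p) ^ Δ ≤ Real.exp (-p) ^ Δ := by
            refine pow_le_pow_left₀ (by linarith) ?_ _
            linarith [Real.add_one_le_exp (-p)]
        _ ≤ Real.exp (-κ) := by
            rw [← Real.exp_nat_mul]
            refine Real.exp_le_exp.2 ?_
            rw [← hpD]
            nlinarith
    have h2 : 1 + 4 * β ≤ Real.exp κ := by linarith [Real.add_one_le_exp κ]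
    calc (1 + 4 * β) * (1 - p) ^ Δ ≤ Real.exp κ * Real.exp (-κ) := by gcongr
      _ = 1 := by rw [← Real.exp_add, add_neg_cancel, Real.exp_zero]
  -- The factor `γ` cancels in the ratio of degree to order; only errors of order `b` remain.
  · have h1 : (1 + 4 * β) * (1 - 6 * b) ≤ (1 - β) * (1 - p) := by
      calc (1 + 4 * β) * (1 - 6 * b) ≤ (1 + 4 * b) * (1 - 6 * b) := by
            have : 0 ≤ 1 - 6 * b := by linarith
            gcongr
        _ ≤ (1 - b) * (1 - b) := by nlinarith
        _ ≤ (1 - β) * (1 - p) := by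
            have : 0 ≤ 1 - b := by linarith
            have : 0 ≤ 1 - β := by linarith
            gcongr
    calc (1 + 4 * β) * (1 - p) ^ Δ * (1 - 6 * b)
        = (1 - p) ^ Δ * ((1 + 4 * β) * (1 - 6 * b)) := by ring
      _ ≤ (1 - p) ^ Δ * ((1 - β) * (1 - p)) := by gcongr
      _ = _ := by ring

/-- What holds throughout a run. Here `κ = ε / 10`, `d` is the average degree and `n` the order of
the input graph, `ρ = d ^ (ε / 20)`, `T` is the maximal number of nibbles, and `b` is an upper bound
for `β`. -/
structure NibbleInvariant {V : Type*} (G : SimpleGraph V) (κ b d n ρ : ℝ) (T : ℕ)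
    (s : NibbleState V) : Prop where
  indep : G.IsIndepSet (s.I : Set V)
  separated : ∀ v ∈ s.U, v ∉ s.I ∧ ∀ u ∈ s.I, ¬ G.Adj u v
  one_le_R : 1 ≤ s.R
  R_le : s.R ≤ 2 * ρ
  le_card : n * Real.exp (-(κ * (1 + κ) + 5 * b)) ^ s.τ ≤ #s.U * s.R
  le_ratio : n * s.D G * s.R ^ (2 * κ) * (1 - 6 * b) ^ s.τ ≤ #s.U * d
  le_card_I : s.τ * ((1 - 2 * κ) * κ * ((1 - 6 * b) ^ T * (n / d))) ≤ #s.I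
  D_le : s.D G ≤ d
  τ_le : s.τ ≤ T

lemma NibbleInvariant.init {V : Type*} [Fintype V] (G : SimpleGraph V) {κ b ρ : ℝ} {T : ℕ}
    (hρ : 1 ≤ ρ) :
    NibbleInvariant G κ b (avgDegree G) (Fintype.card V) ρ T (NibbleState.init V) := by
  have hD : (NibbleState.init V).D G = avgDegree G := by
    classical
    rw [NibbleState.D, NibbleState.graph, avgDegree_inducedOn, card_adjPairs, avgDegree]
    congr 1
    push_cast
    refine sum_congr rfl fun v _ => ?_
    rw [← SimpleGraph.card_neighborFinset_eq_degree]
    congr 2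
    ext w
    simp [NibbleState.init]
  constructor
  · simp [NibbleState.init, SimpleGraph.IsIndepSet]
  · simp [NibbleState.init]
  · simp [NibbleState.init]
  · simp only [NibbleState.init]
    linarith
  · simp [NibbleState.init]
  · rw [hD]
    simp [NibbleState.init]
  · simp [NibbleState.init]
  · exact hD.le
  · simp [NibbleState.init]

open Classical in
-- `R` grows by the factor by which `N` shrinks. The deleted vertex has a neighbour, so `N ≥ 2` and
-- `R` at most doubles: hence the bound `2 ρ` even after the step that crosses `ρ`.
lemma NibbleInvariant.clean {V : Type*} {G : SimpleGraph V} {κ b d n ρ : ℝ} {T : ℕ}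
    {s : NibbleState V} (hs : NibbleInvariant G κ b d n ρ T s) (hκ : 0 ≤ κ) (hb : b ≤ 1 / 6)
    (hn : 0 ≤ n) (hR : s.R ≤ ρ) (v : ((s.U : Set V) : Type _))
    (hv : (1 + κ) * s.D G < ((s.graph G).degree v : ℝ)) :
    NibbleInvariant G κ b d n ρ T
      { I := s.I, U := s.U.erase v.1, R := s.R * ((s.N : ℝ) / ((s.N : ℝ) - 1)), τ := s.τ } := by
  have hvU : v.1 ∈ s.U := v.2
  have hD0 : 0 ≤ s.D G := avgDegree_inducedOn_nonneg G s.U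
  replace hv : (1 + κ) * s.D G < ((inducedOn G s.U).degree v : ℝ) := hv
  rw [degree_inducedOn] at hv
  have hcard : #{w ∈ s.U | G.Adj v w} + 1 ≤ #s.U := by
    rw [← card_erase_add_one hvU]
    refine Nat.add_le_add_right (card_le_card fun w hw => ?_) 1
    rw [mem_filter] at hw
    exact mem_erase.2 ⟨hw.2.ne', hw.1⟩
  have hdeg1 : 1 ≤ #{w ∈ s.U | G.Adj v w} := by
    have : (0 : ℝ) < #{w ∈ s.U | G.Adj v w} := lt_of_le_of_lt (by positivity) hv
    exact_mod_cast this
  have hN2 : (2 : ℝ) ≤ #s.U := by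
    have : 2 ≤ #s.U := by omega
    exact_mod_cast this
  have hN1 : (0 : ℝ) < (#s.U : ℝ) - 1 := by linarith
  have herase : (#(s.U.erase v.1) : ℝ) = (#s.U : ℝ) - 1 := by
    rw [card_erase_of_mem hvU, Nat.cast_sub (by omega), Nat.cast_one]
  have hadj : (#(adjPairs G (s.U.erase v.1)) : ℝ) + 2 * #{w ∈ s.U | G.Adj v w}
      = #(adjPairs G s.U) := by
    exact_mod_cast card_adjPairs_erase G hvU
  have hD' : avgDegree (inducedOn G (s.U.erase v.1)) * ((#s.U : ℝ) - 1)
      ≤ #s.U * s.D G - 2 * ((1 + κ) * s.D G) := by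
    have h1 := avgDegree_inducedOn_mul_card G (s.U.erase v.1)
    have h2 : s.D G * #s.U = #(adjPairs G s.U) := avgDegree_inducedOn_mul_card G s.U
    rw [herase] at h1
    rw [h1, mul_comm (#s.U : ℝ), h2]
    linarith
  obtain ⟨h1, h2⟩ := cleaning_arith hκ hN2 hD0 hD' hs.one_le_R hn
    (pow_nonneg (by linarith) s.τ) hs.le_ratio
  have hr1 : 1 ≤ (#s.U : ℝ) / ((#s.U : ℝ) - 1) := by
    rw [le_div_iff₀ hN1]
    linarith
  have hr2 : (#s.U : ℝ) / ((#s.U : ℝ) - 1) ≤ 2 := by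
    rw [div_le_iff₀ hN1]
    linarith
  have hρ0 : 0 ≤ ρ := by linarith [hs.one_le_R]
  refine ⟨hs.indep, fun w hw => hs.separated w (mem_of_mem_erase hw), ?_, ?_, ?_, ?_,
    hs.le_card_I, h2.trans hs.D_le, hs.τ_le⟩
  · exact one_le_mul_of_one_le_of_one_le hs.one_le_R hr1
  · calc s.R * ((#s.U : ℝ) / ((#s.U : ℝ) - 1)) ≤ ρ * 2 := by gcongr
      _ = 2 * ρ := mul_comm _ _
  · refine hs.le_card.trans (le_of_eq ?_)
    simp only [NibbleState.N, herase]
    field_simp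
  · simp only [NibbleState.N, herase]
    exact h1

/-- `J` lies in the current vertex set, which is separated from `I`, so the union is independent and
disjoint. The gain is proportional to `N / D`, which the ratio bound keeps above `(1 - 6 b) ^ T * (n
/ d)`. -/
lemma NibbleInvariant.nibble {V : Type*} [DecidableEq V] {G : SimpleGraph V}
    {κ b d n ρ : ℝ} {t T : ℕ}
    {s : NibbleState V} (hs : NibbleInvariant G κ b d n ρ T s) (hκ0 : 0 < κ) (hκ1 : κ ≤ 1 / 10)
    (hb : 4 * b ≤ κ) (hn : 0 ≤ n) (hd : 0 < d) (hD : 0 < s.D G) (hτ : s.τ < T)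
    (hp : κ / s.D G ≤ b) (hβ : s.D G ^ (-(1 / (20 * (t : ℝ) ^ 2))) ≤ b)
    (hmax : (maxDeg (s.graph G) : ℝ) ≤ (1 + κ) * s.D G) {J K : Finset V}
    (hout : IsNibbleOutcome t κ G s.U J K) :
    NibbleInvariant G κ b d n ρ T { I := s.I ∪ J, U := K, R := s.R, τ := s.τ + 1 } := by
  have hΔ1 : s.D G ≤ maxDeg (s.graph G) := avgDegree_le_maxDeg _
  obtain ⟨hJU, hJ, hKU, hKJ, hJc, hK1, -, hKD⟩ := hout
  have hβ0 : 0 ≤ s.D G ^ (-(1 / (20 * (t : ℝ) ^ 2))) := by positivity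
  obtain ⟨hγ0, ha1, ha2, ha3⟩ := nibble_step_arith hκ0 hκ1 hD hΔ1 hmax rfl hp hβ0 hβ hb
  change (1 - 2 * κ) * #s.U * (κ / s.D G) ≤ #J at hJc
  change (1 - s.D G ^ (-(1 / (20 * (t : ℝ) ^ 2)))) * ((1 - κ / s.D G) ^ maxDeg (s.graph G)
    * (1 - κ / s.D G) * #s.U) ≤ #K at hK1
  change avgDegree (inducedOn G K) ≤ (1 + 4 * s.D G ^ (-(1 / (20 * (t : ℝ) ^ 2))))
    * (1 - κ / s.D G) ^ maxDeg (s.graph G) * s.D G at hKD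
  generalize s.D G ^ (-(1 / (20 * (t : ℝ) ^ 2))) = β at *
  generalize (1 - κ / s.D G) ^ maxDeg (s.graph G) = γ at *
  have hb0 : 0 ≤ b := hβ0.trans hβ
  have hh0 : 0 < 1 - 6 * b := by linarith
  have hR0 : 0 < s.R := lt_of_lt_of_le one_pos hs.one_le_R
  have hdisj : Disjoint s.I J := by
    rw [disjoint_left]
    exact fun v hvI hvJ => (hs.separated v (hJU hvJ)).1 hvI
  refine ⟨?_, ?_, hs.one_le_R, hs.R_le, ?_, ?_, ?_, ?_, hτ⟩
  · intro u hu v hv huv hadj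
    rcases mem_union.1 (mem_coe.1 hu) with hu | hu <;>
      rcases mem_union.1 (mem_coe.1 hv) with hv | hv
    · exact hs.indep hu hv huv hadj
    · exact (hs.separated v (hJU hv)).2 u hu hadj
    · exact (hs.separated u (hJU hu)).2 v hv hadj.symm
    · exact hJ hu hv huv hadj
  · intro v hv
    obtain ⟨h1, h2⟩ := hs.separated v (hKU hv)
    obtain ⟨h3, h4⟩ := hKJ v hv
    refine ⟨by simp [h1, h3], fun u hu => ?_⟩
    rcases mem_union.1 hu with hu | hu
    · exact h2 u hu
    · exact h4 u hu
  · calc n * Real.exp (-(κ * (1 + κ) + 5 * b)) ^ (s.τ + 1)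
        = Real.exp (-(κ * (1 + κ) + 5 * b))
          * (n * Real.exp (-(κ * (1 + κ) + 5 * b)) ^ s.τ) := by ring
      _ ≤ (1 - β) * (γ * (1 - κ / s.D G)) * (#s.U * s.R) := by
          have := hs.le_card
          have h2 : 0 ≤ (1 - β) * (γ * (1 - κ / s.D G)) := (Real.exp_pos _).le.trans ha1
          gcongr
      _ = (1 - β) * (γ * (1 - κ / s.D G) * #s.U) * s.R := by ring
      _ ≤ #K * s.R := by gcongr
  · change n * avgDegree (inducedOn G K) * s.R ^ (2 * κ) * (1 - 6 * b) ^ (s.τ + 1) ≤ #K * d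
    calc n * avgDegree (inducedOn G K) * s.R ^ (2 * κ) * (1 - 6 * b) ^ (s.τ + 1)
        ≤ n * ((1 + 4 * β) * γ * s.D G) * s.R ^ (2 * κ) * (1 - 6 * b) ^ (s.τ + 1) := by gcongr
      _ = ((1 + 4 * β) * γ * (1 - 6 * b))
          * (n * s.D G * s.R ^ (2 * κ) * (1 - 6 * b) ^ s.τ) := by ring
      _ ≤ ((1 - β) * (γ * (1 - κ / s.D G))) * (#s.U * d) := by
          have := hs.le_ratio
          have h2 : 0 ≤ (1 - β) * (γ * (1 - κ / s.D G)) := (Real.exp_pos _).le.trans ha1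
          gcongr
      _ = (1 - β) * (γ * (1 - κ / s.D G) * #s.U) * d := by ring
      _ ≤ #K * d := by gcongr
  · have h1 : (1 - 6 * b) ^ T * (n / d) ≤ #s.U / s.D G := by
      rw [mul_div_assoc', div_le_div_iff₀ hd hD]
      refine le_trans ?_ hs.le_ratio
      have h2 : (1 - 6 * b) ^ T ≤ (1 - 6 * b) ^ s.τ :=
        pow_le_pow_of_le_one hh0.le (by linarith) hτ.le
      have h3 : 1 ≤ s.R ^ (2 * κ) := Real.one_le_rpow hs.one_le_R (by linarith)
      calc (1 - 6 * b) ^ T * n * s.D G = n * s.D G * 1 * (1 - 6 * b) ^ T := by ring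
        _ ≤ n * s.D G * s.R ^ (2 * κ) * (1 - 6 * b) ^ s.τ := by gcongr
    have h2 : (1 - 2 * κ) * κ * ((1 - 6 * b) ^ T * (n / d)) ≤ #J := by
      refine le_trans ?_ hJc
      have h3 : 0 ≤ (1 - 2 * κ) * κ := mul_nonneg (by linarith) hκ0.le
      calc (1 - 2 * κ) * κ * ((1 - 6 * b) ^ T * (n / d))
          ≤ (1 - 2 * κ) * κ * (#s.U / s.D G) := by gcongr
        _ = _ := by ring
    have h3 := hs.le_card_I
    simp only [card_union_of_disjoint hdisj]
    push_cast
    linarith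
  · calc avgDegree (inducedOn G K) ≤ (1 + 4 * β) * γ * s.D G := hKD
      _ ≤ 1 * s.D G := by gcongr
      _ ≤ d := by rw [one_mul]; exact hs.D_le

end Steps

/-! ### The analysis of the procedure -/

section Analysis

open Finset Filter

/-- A weak form of Turán's bound. -/
lemma card_le_mul_indepNum {W : Type*} [Fintype W] (H : SimpleGraph W) :
    (Fintype.card W : ℝ) ≤ (4 * avgDegree H + 4) * H.indepNum := by
  classical
  have hD0 : 0 ≤ avgDegree H := by rw [avgDegree]; positivity
  set D := avgDegree H with hD
  -- By Markov at least half of the vertices lie in `S`; the `+ 1` covers `D = 0`. The closed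
  -- neighbourhoods of a largest independent subset of `S` cover `S`.
  set S : Finset W := {v | (H.degree v : ℝ) ≤ 2 * D + 1} with hS
  have hcompl : (Fintype.card W : ℝ) ≤ 2 * #S := by
    rcases isEmpty_or_nonempty W with hW | hW
    · simp
    have hc : (Fintype.card W : ℝ) ≠ 0 := by exact_mod_cast Fintype.card_ne_zero
    have h1 : ∑ v, (H.degree v : ℝ) = D * Fintype.card W := by
      rw [hD, avgDegree, div_mul_cancel₀ _ hc]
    have h2 : (2 * D + 1) * #Sᶜ ≤ ∑ v, (H.degree v : ℝ) := by
      calc (2 * D + 1) * #Sᶜ = ∑ v ∈ Sᶜ, (2 * D + 1) := by rw [sum_const, nsmul_eq_mul, mul_comm]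
        _ ≤ ∑ v ∈ Sᶜ, (H.degree v : ℝ) := by
            refine sum_le_sum fun v hv => ?_
            simp only [hS, mem_compl, mem_filter, mem_univ, true_and, not_le] at hv
            exact hv.le
        _ ≤ ∑ v, (H.degree v : ℝ) :=
            sum_le_sum_of_subset_of_nonneg (subset_univ _) fun _ _ _ => by positivity
    have h3 : (#S : ℝ) + #Sᶜ = Fintype.card W := by exact_mod_cast card_add_card_compl S
    have h4 : (0 : ℝ) ≤ #Sᶜ := by positivity
    have h5 : (0 : ℝ) ≤ #S := by positivity
    nlinarith
  obtain ⟨I, hI, hmax⟩ := exists_max_image (S.powerset.filter fun I : Finset W => H.IsIndepSet (I : Set W))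
    Finset.card ⟨∅, by simp [SimpleGraph.IsIndepSet]⟩
  rw [mem_filter, mem_powerset] at hI
  have hcover : S ⊆ I.biUnion fun v => insert v (H.neighborFinset v) := by
    intro w hw
    by_contra hnot
    simp only [mem_biUnion, mem_insert, SimpleGraph.mem_neighborFinset, not_exists, not_and,
      not_or] at hnot
    have hwI : w ∉ I := fun h => (hnot w h).1 rfl
    have := hmax (insert w I) (by
      rw [mem_filter, mem_powerset]
      refine ⟨insert_subset hw hI.1, ?_⟩
      rw [coe_insert]
      intro u hu v hv huv hadj
      rcases hu with rfl | hu <;> rcases hv with rfl | hv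
      · exact huv rfl
      · exact (hnot v hv).2 hadj.symm
      · exact (hnot u hu).2 hadj
      · exact hI.2 hu hv huv hadj)
    rw [card_insert_of_notMem hwI] at this
    omega
  have hScard : (#S : ℝ) ≤ (2 * D + 2) * #I := by
    calc (#S : ℝ) ≤ ∑ v ∈ I, (#(insert v (H.neighborFinset v)) : ℝ) := by
          exact_mod_cast (card_le_card hcover).trans card_biUnion_le
      _ ≤ ∑ v ∈ I, (2 * D + 2) := by
          refine sum_le_sum fun v hv => ?_
          have h1 : (H.degree v : ℝ) ≤ 2 * D + 1 := (mem_filter.1 (hI.1 hv)).2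
          have h2 : (#(insert v (H.neighborFinset v)) : ℝ) ≤ H.degree v + 1 := by
            exact_mod_cast card_insert_le _ _
          linarith
      _ = (2 * D + 2) * #I := by rw [sum_const, nsmul_eq_mul, mul_comm]
  have hIα : (#I : ℝ) ≤ H.indepNum := by exact_mod_cast hI.2.card_le_indepNum
  calc (Fintype.card W : ℝ) ≤ 2 * ((2 * D + 2) * #I) := by linarith
    _ ≤ 2 * ((2 * D + 2) * H.indepNum) := by gcongr
    _ = _ := by ring

lemma indepNum_inducedOn_le {V : Type*} [Fintype V] (G : SimpleGraph V) (U : Finset V) :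
    (inducedOn G U).indepNum ≤ G.indepNum := by
  obtain ⟨S, hS⟩ := (inducedOn G U).exists_isNIndepSet_indepNum
  rw [← hS.card_eq, ← card_map (Function.Embedding.subtype _)]
  refine SimpleGraph.IsIndepSet.card_le_indepNum ?_
  intro u hu v hv huv hadj
  obtain ⟨u, huS, rfl⟩ := mem_map.1 (mem_coe.1 hu)
  obtain ⟨v, hvS, rfl⟩ := mem_map.1 (mem_coe.1 hv)
  exact hS.isIndepSet huS hvS (fun h => huv (congrArg _ h)) hadj

/-- The maximal number of nibbles. -/
noncomputable def maxNibbles (ε d : ℝ) : ℕ :=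
  ⌈10 * (1 - ε / 3) * Real.log d / ((1 + ε / 5) * ε)⌉₊

/-- An upper bound for all the numbers `β` in a run. -/
noncomputable def betaBound (ε d : ℝ) (t : ℕ) : ℝ := d ^ (-(ε / 8 * (1 / (20 * (t : ℝ) ^ 2))))

/-- The conditions on the average degree `d` of the input graph. -/
structure LargeDegree (ε d : ℝ) (t : ℕ) : Prop where
  one_le : 1 ≤ d
  betaBound_le : 4 * betaBound ε d t ≤ ε / 10
  mul_maxNibbles_le : 6 * betaBound ε d t * maxNibbles ε d ≤ ε / 10
  log_le : 64 * Real.log d ≤ d ^ (19 * ε / 120)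
  log_le' : 16 * Real.log d ≤ d ^ (ε ^ 2 / 100)

lemma eventually_mul_log_le {r c : ℝ} (hr : 0 < r) (hc : 0 < c) :
    ∀ᶠ d : ℝ in atTop, c * Real.log d ≤ d ^ r := by
  filter_upwards [(isLittleO_log_rpow_atTop hr).bound (inv_pos.2 hc), eventually_ge_atTop 1]
    with d hd hd1
  rw [Real.norm_of_nonneg (Real.log_nonneg hd1), Real.norm_of_nonneg (by positivity)] at hd
  calc c * Real.log d ≤ c * (c⁻¹ * d ^ r) := by gcongr
    _ = d ^ r := by field_simp

/-- `betaBound` is a negative power of `d` and `maxNibbles` is of order `log d`, so even their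
product tends to zero. -/
lemma eventually_largeDegree {ε : ℝ} (hε₀ : 0 < ε) (hε₁ : ε < 1) {t : ℕ} (ht : 1 ≤ t) :
    ∀ᶠ d : ℝ in atTop, LargeDegree ε d t := by
  have htR : (0 : ℝ) < t := by exact_mod_cast ht
  have hr : 0 < ε / 8 * (1 / (20 * (t : ℝ) ^ 2)) := by positivity
  have hx0 : 0 < 10 * (1 - ε / 3) / ((1 + ε / 5) * ε) :=
    div_pos (by linarith) (by positivity)
  obtain ⟨x, hx⟩ : ∃ x, x = 10 * (1 - ε / 3) / ((1 + ε / 5) * ε) := ⟨_, rfl⟩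
  rw [← hx] at hx0
  filter_upwards [eventually_ge_atTop 1,
    (tendsto_rpow_neg_atTop hr).eventually_le_const (show 0 < ε / 120 by positivity),
    eventually_mul_log_le hr (show 0 < 120 * x / ε by positivity),
    eventually_mul_log_le (show 0 < 19 * ε / 120 by positivity) (show (0 : ℝ) < 64 by norm_num),
    eventually_mul_log_le (show 0 < ε ^ 2 / 100 by positivity) (show (0 : ℝ) < 16 by norm_num)]
    with d h1 h2 h3 h4 h5
  have hd0 : 0 < d := by linarith
  have hb0 : 0 < betaBound ε d t := Real.rpow_pos_of_pos hd0 _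
  refine ⟨h1, ?_, ?_, h4, h5⟩
  · rw [betaBound]
    linarith
  · have hT : (maxNibbles ε d : ℝ) ≤ x * Real.log d + 1 := by
      have h6 : 10 * (1 - ε / 3) * Real.log d / ((1 + ε / 5) * ε) = x * Real.log d := by
        rw [hx]
        ring
      rw [maxNibbles, h6]
      exact (Nat.ceil_lt_add_one (mul_nonneg hx0.le (Real.log_nonneg h1))).le
    have h7 : betaBound ε d t * (x * Real.log d) ≤ ε / 120 := by
      have h8 : betaBound ε d t * d ^ (ε / 8 * (1 / (20 * (t : ℝ) ^ 2))) = 1 := by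
        rw [betaBound, ← Real.rpow_add hd0, neg_add_cancel, Real.rpow_zero]
      calc betaBound ε d t * (x * Real.log d)
          = ε / 120 * (betaBound ε d t * (120 * x / ε * Real.log d)) := by
            field_simp
        _ ≤ ε / 120 * (betaBound ε d t * d ^ (ε / 8 * (1 / (20 * (t : ℝ) ^ 2)))) := by gcongr
        _ = ε / 120 := by rw [h8, mul_one]
    have h9 : betaBound ε d t ≤ ε / 120 := h2
    calc 6 * betaBound ε d t * maxNibbles ε d
        ≤ 6 * betaBound ε d t * (x * Real.log d + 1) := by gcongr
      _ = 6 * (betaBound ε d t * (x * Real.log d)) + 6 * betaBound ε d t := by ring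
      _ ≤ ε / 10 := by linarith

/-- A lower bound for the fraction of vertices that survives all the nibbles. -/
lemma LargeDegree.le_exp_pow {ε d : ℝ} {t : ℕ} (h : LargeDegree ε d t) (hε₀ : 0 < ε)
    (hε₁ : ε < 1) :
    d ^ (-(1 - ε / 3)) / 4
      ≤ Real.exp (-(ε / 10 * (1 + ε / 10) + 5 * betaBound ε d t)) ^ maxNibbles ε d := by
  have hd0 : 0 < d := by linarith [h.one_le]
  have hb0 : 0 < betaBound ε d t := Real.rpow_pos_of_pos hd0 _
  have hL : 0 ≤ Real.log d := Real.log_nonneg h.one_le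
  have hx0 : 0 ≤ 10 * (1 - ε / 3) * Real.log d / ((1 + ε / 5) * ε) :=
    div_nonneg (mul_nonneg (by linarith) hL) (by positivity)
  have hT : (maxNibbles ε d : ℝ) ≤ 10 * (1 - ε / 3) * Real.log d / ((1 + ε / 5) * ε) + 1 :=
    (Nat.ceil_lt_add_one hx0).le
  -- The divisor `1 + ε / 5` in the number of nibbles outweighs the `1 + κ` lost to the maximum
  -- degree; `1 / 4` pays for the ceiling.
  have h1 : maxNibbles ε d * (ε / 10 * (1 + ε / 10)) ≤ (1 - ε / 3) * Real.log d + 1 / 4 := by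
    calc maxNibbles ε d * (ε / 10 * (1 + ε / 10))
        ≤ (10 * (1 - ε / 3) * Real.log d / ((1 + ε / 5) * ε) + 1)
          * (ε / 10 * (1 + ε / 10)) := by gcongr
      _ = (1 - ε / 3) * Real.log d * ((1 + ε / 10) / (1 + ε / 5))
          + ε / 10 * (1 + ε / 10) := by field_simp
      _ ≤ (1 - ε / 3) * Real.log d * 1 + 1 / 4 := by
          have h2 : (1 + ε / 10) / (1 + ε / 5) ≤ 1 := (div_le_one (by positivity)).2 (by linarith)
          have h3 : 0 ≤ (1 - ε / 3) * Real.log d := mul_nonneg (by linarith) hL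
          have h4 : ε / 10 * (1 + ε / 10) ≤ 1 / 4 := by nlinarith
          gcongr
      _ = _ := by ring
  have h2 := h.mul_maxNibbles_le
  rw [← Real.exp_nat_mul, Real.rpow_def_of_pos hd0]
  have h3 : Real.exp (Real.log d * -(1 - ε / 3) - 1)
      ≤ Real.exp (maxNibbles ε d * -(ε / 10 * (1 + ε / 10) + 5 * betaBound ε d t)) := by
    refine Real.exp_le_exp.2 ?_
    have : 0 ≤ betaBound ε d t * maxNibbles ε d := by positivity
    linarith
  refine le_trans ?_ h3
  rw [Real.exp_sub]
  have h4 : Real.exp 1 ≤ 4 := by linarith [Real.exp_one_lt_d9]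
  gcongr

lemma LargeDegree.one_sub_le_pow {ε d : ℝ} {t : ℕ} (h : LargeDegree ε d t) (hε₁ : ε < 1) :
    1 - ε / 10 ≤ (1 - 6 * betaBound ε d t) ^ maxNibbles ε d := by
  have h1 := one_add_mul_le_pow (a := -(6 * betaBound ε d t))
    (by linarith [h.betaBound_le]) (maxNibbles ε d)
  rw [← sub_eq_add_neg] at h1
  linarith [h.mul_maxNibbles_le]

/-- The lower bounds for `|I|` and `α(H)` at the end of a run. -/
lemma LargeDegree.final_bound {ε d : ℝ} {t : ℕ} (h : LargeDegree ε d t) (hε₀ : 0 < ε)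
    (hε₁ : ε < 1) {n N D R i α : ℝ} {τ : ℕ} (hn : 0 ≤ n) (hR1 : 1 ≤ R)
    (hR2 : R ≤ 2 * d ^ (ε / 20)) (hα : 0 ≤ α)
    (hN : n * Real.exp (-(ε / 10 * (1 + ε / 10) + 5 * betaBound ε d t)) ^ τ ≤ N * R)
    (hND : n * D * R ^ (2 * (ε / 10)) * (1 - 6 * betaBound ε d t) ^ τ ≤ N * d)
    (hi : τ * ((1 - 2 * (ε / 10)) * (ε / 10)
      * ((1 - 6 * betaBound ε d t) ^ maxNibbles ε d * (n / d))) ≤ i)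
    (hτ : τ ≤ maxNibbles ε d) (hNα : N ≤ (4 * D + 4) * α)
    (hend : D < d ^ (ε / 8) ∨ d ^ (ε / 20) < R ∨ τ = maxNibbles ε d) :
    (1 - ε) * (n * Real.log d / d) ≤ i ∨ (1 - ε) * (n * Real.log d / d) ≤ α := by
  have hd1 := h.one_le
  have hd0 : 0 < d := by linarith
  have hb0 : 0 < betaBound ε d t := Real.rpow_pos_of_pos hd0 _
  have hb1 := h.betaBound_le
  have hL : 0 ≤ Real.log d := Real.log_nonneg hd1
  have hnd : 0 ≤ n * Real.log d / d := by positivity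
  have hweak : (1 - ε) * (n * Real.log d / d) ≤ n * Real.log d / d := by nlinarith
  have hpow := h.one_sub_le_pow hε₁
  by_cases hcase : D < d ^ (ε / 8)
  · right
    refine hweak.trans ?_
    have hg := h.le_exp_pow hε₀ hε₁
    have hB1 : 1 ≤ d ^ (ε / 8) := Real.one_le_rpow hd1 (by positivity)
    have hA0 : 0 < d ^ (ε / 20) := by positivity
    -- `ε / 3 = ε / 8 + ε / 20 + 19 ε / 120`: after paying for `D` and `R`, the last power beats `64
    -- log d`.
    have hE : d ^ (-(1 - ε / 3)) = d⁻¹ * d ^ (19 * ε / 120) * (d ^ (ε / 20) * d ^ (ε / 8)) := by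
      rw [← Real.rpow_neg_one, ← Real.rpow_add hd0, ← Real.rpow_add hd0, ← Real.rpow_add hd0]
      congr 1
      ring
    have h1 : n * (d ^ (-(1 - ε / 3)) / 4) ≤ 8 * d ^ (ε / 8) * α * (2 * d ^ (ε / 20)) := by
      calc n * (d ^ (-(1 - ε / 3)) / 4)
          ≤ n * Real.exp (-(ε / 10 * (1 + ε / 10) + 5 * betaBound ε d t)) ^ maxNibbles ε d := by
            gcongr
        _ ≤ n * Real.exp (-(ε / 10 * (1 + ε / 10) + 5 * betaBound ε d t)) ^ τ := by
            refine mul_le_mul_of_nonneg_left (pow_le_pow_of_le_one (Real.exp_pos _).le ?_ hτ) hn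
            rw [Real.exp_le_one_iff, neg_nonpos]
            positivity
        _ ≤ N * R := hN
        _ ≤ (4 * D + 4) * α * R := by gcongr
        _ ≤ 8 * d ^ (ε / 8) * α * (2 * d ^ (ε / 20)) := by
            gcongr
            linarith
    rw [hE] at h1
    have h2 : n * (d⁻¹ * d ^ (19 * ε / 120)) ≤ 64 * α := by
      have hAB : 0 < d ^ (ε / 20) * d ^ (ε / 8) := by positivity
      refine le_of_mul_le_mul_right ?_ hAB
      linarith
    have h3 : n * (d⁻¹ * (64 * Real.log d)) ≤ n * (d⁻¹ * d ^ (19 * ε / 120)) := by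
      have := h.log_le
      gcongr
    calc n * Real.log d / d = n * (d⁻¹ * (64 * Real.log d)) / 64 := by field_simp
      _ ≤ α := by linarith
  · have hDB : 1 ≤ D := (Real.one_le_rpow hd1 (by positivity)).trans (not_lt.1 hcase)
    rcases hend with hend | hend | hend
    · exact absurd hend hcase
    · right
      refine hweak.trans ?_
      -- The ratio `N / D` has gained this factor by cleaning, which exceeds `16 log d`.
      have h1 : d ^ (ε ^ 2 / 100) ≤ R ^ (2 * (ε / 10)) := by
        calc d ^ (ε ^ 2 / 100) = (d ^ (ε / 20)) ^ (2 * (ε / 10)) := by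
              rw [← Real.rpow_mul hd0.le]
              congr 1
              ring
          _ ≤ R ^ (2 * (ε / 10)) :=
              Real.rpow_le_rpow (by positivity) hend.le (by positivity)
      have h2 : 1 / 2 ≤ (1 - 6 * betaBound ε d t) ^ τ := by
        have h3 : (1 - 6 * betaBound ε d t) ^ maxNibbles ε d ≤ (1 - 6 * betaBound ε d t) ^ τ :=
          pow_le_pow_of_le_one (by linarith) (by linarith) hτ
        linarith
      have h4 : D * (n * Real.log d) ≤ D * (α * d) := by
        have h5 : n * D * (16 * Real.log d) * (1 / 2) ≤ 8 * D * α * d := by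
          calc n * D * (16 * Real.log d) * (1 / 2)
              ≤ n * D * R ^ (2 * (ε / 10)) * (1 - 6 * betaBound ε d t) ^ τ := by
                have := h.log_le'.trans h1
                gcongr
            _ ≤ N * d := hND
            _ ≤ (4 * D + 4) * α * d := by gcongr
            _ ≤ 8 * D * α * d := by
                gcongr
                linarith
        linarith
      rw [div_le_iff₀ hd0]
      exact le_of_mul_le_mul_left h4 (by linarith)
    · left
      refine le_trans ?_ hi
      have hT : 10 * (1 - ε / 3) * Real.log d / ((1 + ε / 5) * ε) ≤ τ := by
        rw [hend]
        exact Nat.le_ceil _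
      have h1 : 0 ≤ (1 - 2 * (ε / 10)) * (ε / 10) := mul_nonneg (by linarith) (by positivity)
      -- To first order the losses add up to `ε / 3 + ε / 5 + ε / 5 + ε / 10 = 5 ε / 6`.
      have h2 : 1 - ε ≤ (1 - ε / 3) * (1 - 2 * (ε / 10)) / (1 + ε / 5) * (1 - ε / 10) := by
        rw [div_mul_eq_mul_div, le_div_iff₀ (by positivity)]
        nlinarith [mul_pos hε₀ hε₀, mul_pos (mul_pos hε₀ hε₀) (sub_pos.2 hε₁)]
      calc (1 - ε) * (n * Real.log d / d)
          ≤ (1 - ε / 3) * (1 - 2 * (ε / 10)) / (1 + ε / 5) * (1 - ε / 10)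
            * (n * Real.log d / d) := by gcongr
        _ = 10 * (1 - ε / 3) * Real.log d / ((1 + ε / 5) * ε) * ((1 - 2 * (ε / 10)) * (ε / 10)
            * ((1 - ε / 10) * (n / d))) := by field_simp
        _ ≤ τ * ((1 - 2 * (ε / 10)) * (ε / 10)
            * ((1 - 6 * betaBound ε d t) ^ maxNibbles ε d * (n / d))) := by
            have h3 : 0 ≤ 1 - ε / 10 := by linarith
            gcongr

end Analysis

/-! ### Termination and conclusion -/

section Conclusion

open Finset Filter

lemma LargeDegree.rpow_le_betaBound {ε d D : ℝ} {t : ℕ} (h : LargeDegree ε d t)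
    (hD : d ^ (ε / 8) ≤ D) : D ^ (-(1 / (20 * (t : ℝ) ^ 2))) ≤ betaBound ε d t := by
  have hd0 : 0 < d := by linarith [h.one_le]
  calc D ^ (-(1 / (20 * (t : ℝ) ^ 2))) ≤ (d ^ (ε / 8)) ^ (-(1 / (20 * (t : ℝ) ^ 2))) :=
        Real.rpow_le_rpow_of_nonpos (by positivity) hD (neg_nonpos.2 (by positivity))
    _ = betaBound ε d t := by
        rw [← Real.rpow_mul hd0.le, betaBound]
        congr 1
        ring

lemma LargeDegree.div_le_betaBound {ε d D : ℝ} {t : ℕ} (h : LargeDegree ε d t) (hε₀ : 0 < ε)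
    (hε₁ : ε < 1) (ht : 1 ≤ t) (hD : d ^ (ε / 8) ≤ D) : ε / 10 / D ≤ betaBound ε d t := by
  have hd0 : 0 < d := by linarith [h.one_le]
  have htR : (1 : ℝ) ≤ (t : ℝ) ^ 2 := one_le_pow₀ (by exact_mod_cast ht)
  have hB : 0 < d ^ (ε / 8) := by positivity
  calc ε / 10 / D ≤ 1 / d ^ (ε / 8) := by
        gcongr
        linarith
    _ = d ^ (-(ε / 8)) := by rw [Real.rpow_neg hd0.le, one_div]
    _ ≤ betaBound ε d t := by
        refine Real.rpow_le_rpow_of_exponent_le h.one_le (neg_le_neg ?_)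
        refine mul_le_of_le_one_right (by positivity) ?_
        rw [div_le_one (by positivity)]
        linarith

variable {V : Type*} [Fintype V] {G : SimpleGraph V} {ε : ℝ} {t : ℕ}

/-- The invariant on a run on the input `(G, ε)`. -/
abbrev RunInvariant (t : ℕ) (ε : ℝ) (G : SimpleGraph V) (s : NibbleState V) : Prop :=
  NibbleInvariant G (ε / 10) (betaBound ε (avgDegree G) t) (avgDegree G) (Fintype.card V)
    (avgDegree G ^ (ε / 20)) (maxNibbles ε (avgDegree G)) s

lemma NibbleState.not_stopped_iff {s : NibbleState V} : ¬ s.Stopped ε G ↔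
    avgDegree G ^ (ε / 8) ≤ s.D G ∧ s.R ≤ avgDegree G ^ (ε / 20) ∧
      s.τ ≠ maxNibbles ε (avgDegree G) := by
  rw [NibbleState.Stopped, not_or, not_or, not_lt, not_lt, maxNibbles]

lemma runInvariant_of_step (h : LargeDegree ε (avgDegree G) t) (hε₀ : 0 < ε) (hε₁ : ε < 1)
    (ht : 1 ≤ t) {s s' : NibbleState V} (hs : RunInvariant t ε G s)
    (hstep : NibbleStep t ε G s s') : RunInvariant t ε G s' := by
  classical
  have hb := h.betaBound_le
  have hd0 : 0 < avgDegree G := by linarith [h.one_le]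
  cases hstep with
  | clean v hgo hv =>
    obtain ⟨-, hR, -⟩ := NibbleState.not_stopped_iff.1 hgo
    exact hs.clean (by positivity) (by linarith) (by positivity) hR v hv
  | nibble J K hgo hmax hout =>
    obtain ⟨hD, -, hτ⟩ := NibbleState.not_stopped_iff.1 hgo
    exact hs.nibble (by positivity) (by linarith) hb (by positivity) hd0
      (lt_of_lt_of_le (by positivity) hD) (lt_of_le_of_ne hs.τ_le hτ)
      (h.div_le_betaBound hε₀ hε₁ ht hD) (h.rpow_le_betaBound hD) hmax hout

lemma runInvariant_of_reachable (h : LargeDegree ε (avgDegree G) t) (hε₀ : 0 < ε) (hε₁ : ε < 1)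
    (ht : 1 ≤ t) {s : NibbleState V} (hs : NibbleReachable t ε G s) : RunInvariant t ε G s := by
  induction hs with
  | refl => exact NibbleInvariant.init G (Real.one_le_rpow h.one_le (by positivity))
  | tail _ hstep ih => exact runInvariant_of_step h hε₀ hε₁ ht ih hstep

/-- The number of steps that remain at most. -/
noncomputable def remainingSteps (ε : ℝ) (G : SimpleGraph V) (s : NibbleState V) : ℕ :=
  maxNibbles ε (avgDegree G) - s.τ + #s.U

/-- Cleaning removes a vertex. A nibble adds none and raises `τ`, which is still below its maximum,
so the truncated subtraction really drops. -/
lemma remainingSteps_lt {s s' : NibbleState V} (hτ : s.τ ≤ maxNibbles ε (avgDegree G))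
    (hstep : NibbleStep t ε G s s') : remainingSteps ε G s' < remainingSteps ε G s := by
  classical
  cases hstep with
  | clean v hgo hv =>
    refine Nat.add_lt_add_left ?_ _
    exact card_lt_card (erase_ssubset v.2)
  | nibble J K hgo hmax hout =>
    obtain ⟨-, -, hne⟩ := NibbleState.not_stopped_iff.1 hgo
    have hK : #K ≤ #s.U := card_le_card hout.2.2.1
    simp only [remainingSteps]
    omega

/-- What is needed of the graph for the procedure to be well defined. -/
lemma nibbleWellDefined_of_exists (h : LargeDegree ε (avgDegree G) t) (hε₀ : 0 < ε) (hε₁ : ε < 1)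
    (ht : 1 ≤ t)
    (hex : ∀ s : NibbleState V, RunInvariant t ε G s → ¬ s.Stopped ε G →
      (maxDeg (s.graph G) : ℝ) ≤ (1 + ε / 10) * s.D G →
      ∃ J K : Finset V, IsNibbleOutcome t (ε / 10) G s.U J K) :
    NibbleWellDefined t ε G := by
  classical
  constructor
  · rintro ⟨f, hf0, hf⟩
    have hreach : ∀ i, NibbleReachable t ε G (f i) := by
      intro i
      induction i with
      | zero => rw [hf0]; exact Relation.ReflTransGen.refl
      | succ i ih => exact ih.tail (hf i)
    have hdec : ∀ i, remainingSteps ε G (f (i + 1)) < remainingSteps ε G (f i) := fun i =>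
      remainingSteps_lt (runInvariant_of_reachable h hε₀ hε₁ ht (hreach i)).τ_le (hf i)
    have hle : ∀ i, remainingSteps ε G (f i) + i ≤ remainingSteps ε G (f 0) := by
      intro i
      induction i with
      | zero => exact le_rfl
      | succ i ih => have := hdec i; omega
    have := hle (remainingSteps ε G (f 0) + 1)
    omega
  · intro s hs
    have hinv := runInvariant_of_reachable h hε₀ hε₁ ht hs
    by_cases hgo : s.Stopped ε G
    · exact Or.inl hgo
    right
    by_cases hv : ∃ v, (1 + ε / 10) * s.D G < ((s.graph G).degree v : ℝ)
    · obtain ⟨v, hv⟩ := hv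
      refine ⟨_, NibbleStep.clean s v hgo ?_⟩
      convert hv
    · push Not at hv
      have hmax : (maxDeg (s.graph G) : ℝ) ≤ (1 + ε / 10) * s.D G := by
        obtain ⟨hD, -, -⟩ := NibbleState.not_stopped_iff.1 hgo
        have hd0 : 0 < avgDegree G := by linarith [h.one_le]
        have hD0 : 0 < s.D G := lt_of_lt_of_le (by positivity) hD
        have hne : Nonempty ((s.U : Set V) : Type _) := by
          by_contra hempty
          rw [not_nonempty_iff] at hempty
          have : s.D G = 0 := by
            rw [NibbleState.D, avgDegree]
            simp
          linarith
        obtain ⟨v, hv'⟩ := (s.graph G).exists_maximal_degree_vertex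
        have h1 : maxDeg (s.graph G) = (s.graph G).degree v := by
          rw [← hv', maxDeg]
          congr!
        rw [h1]
        convert hv v
      obtain ⟨J, K, hout⟩ := hex s hinv hgo hmax
      exact ⟨_, NibbleStep.nibble s J K hgo hmax hout⟩

lemma exists_isNibbleOutput (h : LargeDegree ε (avgDegree G) t) (hε₀ : 0 < ε) (hε₁ : ε < 1)
    (ht : 1 ≤ t) (hwd : NibbleWellDefined t ε G) : ∃ I U, IsNibbleOutput t ε G I U := by
  have key : ∀ k, ∀ s, NibbleReachable t ε G s → remainingSteps ε G s = k →
      ∃ I U, IsNibbleOutput t ε G I U := by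
    intro k
    induction k using Nat.strong_induction_on with
    | _ k ih =>
      intro s hs hk
      rcases hwd.2 s hs with hend | ⟨s', hs'⟩
      · exact ⟨s.I, s.U, s, hs, hend, rfl, rfl⟩
      · have hlt := remainingSteps_lt (runInvariant_of_reachable h hε₀ hε₁ ht hs).τ_le hs'
        exact ih _ (hk ▸ hlt) s' (hs.tail hs') rfl
  exact key _ _ Relation.ReflTransGen.refl rfl

lemma isNibbleOutput_spec (h : LargeDegree ε (avgDegree G) t) (hε₀ : 0 < ε) (hε₁ : ε < 1)
    (ht : 1 ≤ t) {I U : Finset V} (hout : IsNibbleOutput t ε G I U) :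
    G.IsIndepSet (I : Set V) ∧ (∀ v ∈ U, v ∉ I ∧ ∀ u ∈ I, ¬ G.Adj u v) ∧
      ((1 - ε) * (Fintype.card V * Real.log (avgDegree G) / avgDegree G) ≤ (#I : ℝ) ∨
        (1 - ε) * (Fintype.card V * Real.log (avgDegree G) / avgDegree G)
          ≤ ((inducedOn G U).indepNum : ℝ)) := by
  classical
  obtain ⟨s, hs, hend, rfl, rfl⟩ := hout
  have hinv := runInvariant_of_reachable h hε₀ hε₁ ht hs
  have hα := card_le_mul_indepNum (inducedOn G s.U)
  rw [show Fintype.card (s.U : Set V) = #s.U by simp] at hα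
  exact ⟨hinv.indep, hinv.separated, h.final_bound hε₀ hε₁ (by positivity)
    hinv.one_le_R hinv.R_le (by positivity) hinv.le_card hinv.le_ratio hinv.le_card_I hinv.τ_le
    hα hend⟩

end Conclusion

theorem mainTheorem8 (ε : ℝ) (hε₀ : 0 < ε) (hε₁ : ε < 1) (t : ℕ) :
    ∃ d₀ : ℝ, ∀ d : ℝ, d₀ ≤ d → ∃ n₀ : ℕ, ∀ n : ℕ, n₀ ≤ n →
      ∀ (V : Type*) [Fintype V] (G : SimpleGraph V),
        Fintype.card V = n →
        (SimpleGraph.completeEquipartiteGraph 3 t).Free G →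
        avgDegree G = d →
        NibbleWellDefined t ε G ∧
        (∀ I U : Finset V, IsNibbleOutput t ε G I U →
          G.IsIndepSet (I : Set V) ∧
          (∀ v ∈ U, v ∉ I ∧ ∀ u ∈ I, ¬ G.Adj u v) ∧
          ((1 - ε) * ((n : ℝ) * Real.log d / d) ≤ (I.card : ℝ) ∨
            (1 - ε) * ((n : ℝ) * Real.log d / d) ≤ ((inducedOn G U).indepNum : ℝ))) ∧
        (1 - ε) * ((n : ℝ) * Real.log d / d) ≤ (G.indepNum : ℝ) := by
  rcases Nat.eq_zero_or_pos t with rfl | ht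
  -- For `t = 0` the forbidden graph has no vertices and is contained in every graph.
  · exact ⟨0, fun d _ => ⟨0, fun n _ V _ G _ hfree => absurd
      ⟨⟨⟨fun a => a.2.elim0, fun {a} => a.2.elim0⟩, fun a => a.2.elim0⟩⟩ hfree⟩⟩
  obtain ⟨D₀, hD₀⟩ := exists_isNibbleOutcome t ht (κ := ε / 10) (by positivity) (by linarith)
  have hev : ∀ᶠ d : ℝ in Filter.atTop, LargeDegree ε d t ∧ D₀ ≤ d ^ (ε / 8) :=
    (eventually_largeDegree hε₀ hε₁ ht).and
      ((tendsto_rpow_atTop (by positivity)).eventually_ge_atTop D₀)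
  obtain ⟨d₀, hd₀⟩ := Filter.eventually_atTop.1 hev
  refine ⟨d₀, fun d hd => ?_⟩
  obtain ⟨hlarge, hDd⟩ := hd₀ d hd
  -- The average degree never exceeds `d` during a run, so `M = d`.
  obtain ⟨N₀, hN₀⟩ := hD₀ d
  have hd1 := hlarge.one_le
  have hdpos : 0 < d := by linarith
  -- Before stopping, `R ≤ d ^ (ε / 20)`, so the bound for `N R` leaves at least `c n` vertices; `n
  -- ≥ N₀ / c` thus admits every nibble.
  obtain ⟨c, hc⟩ : ∃ c, c = Real.exp (-(ε / 10 * (1 + ε / 10) + 5 * betaBound ε d t))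
    ^ maxNibbles ε d / d ^ (ε / 20) := ⟨_, rfl⟩
  have hc0 : 0 < c := by rw [hc]; positivity
  refine ⟨⌈N₀ / c⌉₊, fun n hn V _ G hV hfree hG => ?_⟩
  subst hG
  subst hV
  have hex : ∀ s : NibbleState V, RunInvariant t ε G s → ¬ s.Stopped ε G →
      (maxDeg (s.graph G) : ℝ) ≤ (1 + ε / 10) * s.D G →
      ∃ J K : Finset V, IsNibbleOutcome t (ε / 10) G s.U J K := by
    intro s hs hgo hmax
    obtain ⟨hD, hR, -⟩ := NibbleState.not_stopped_iff.1 hgo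
    refine hN₀ V G s.U hfree ?_ (hDd.trans hD) hs.D_le hmax
    have hb0 : 0 < betaBound ε (avgDegree G) t := Real.rpow_pos_of_pos hdpos _
    have hρ : 0 < avgDegree G ^ (ε / 20) := by positivity
    have h1 : (N₀ : ℝ) ≤ Fintype.card V * c := by
      rw [← div_le_iff₀ hc0]
      exact (Nat.le_ceil _).trans (by exact_mod_cast hn)
    have h2 : (N₀ : ℝ) ≤ (s.U.card : ℝ) := by
      refine h1.trans ?_
      rw [hc, mul_div_assoc', div_le_iff₀ hρ]
      calc _ ≤ Fintype.card V * Real.exp (-(ε / 10 * (1 + ε / 10)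
            + 5 * betaBound ε (avgDegree G) t)) ^ s.τ := by
            refine mul_le_mul_of_nonneg_left
              (pow_le_pow_of_le_one (Real.exp_pos _).le ?_ hs.τ_le) (by positivity)
            rw [Real.exp_le_one_iff, neg_nonpos]
            positivity
        _ ≤ s.U.card * s.R := hs.le_card
        _ ≤ s.U.card * avgDegree G ^ (ε / 20) := by gcongr
    exact_mod_cast h2
  have hwd := nibbleWellDefined_of_exists hlarge hε₀ hε₁ ht hex
  have hspec := fun I U => isNibbleOutput_spec (I := I) (U := U) hlarge hε₀ hε₁ ht
  refine ⟨hwd, hspec, ?_⟩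
  obtain ⟨I, U, hout⟩ := exists_isNibbleOutput hlarge hε₀ hε₁ ht hwd
  obtain ⟨hI, -, hIU⟩ := hspec I U hout
  rcases hIU with h | h
  · exact h.trans (by exact_mod_cast hI.card_le_indepNum)
  · exact h.trans (by exact_mod_cast indepNum_inducedOn_le G U)
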